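/- **Theorem.** Let $\Bbbk$ be a field, $n \ge 0$, and let $I \subseteq \Bbbk[\mathbf x] = \Bbbk[x_1,\dots,x_n]$ be a monomial ideal. For $\mathbf b \in \mathbb N^n$ let $K^{\mathbf b}I = \{\tau \subseteq \{1,\dots,n\} : \mathbf x^{\mathbf b-\tau} \in I\}$ be its (upper) Koszul simplicial complex, where $\tau$ is identified with its indicator vector and $\mathbf b-\tau$ is required to lie in $\mathbb N^n$. Let $\partial^{\mathbf b}_i : \widetilde C_i K^{\mathbf b}I \to \widetilde C_{i-1}K^{\mathbf b}I$ be the differentials of its reduced chain complex over $\Bbbk$, in which the coefficient of $\tau\smallsetminus k$ in the boundary of a face $\tau \ni k$ is the usual sign $(-1)^{\tau\smallsetminus k\subset\tau} = (-1)^{\#\{l\in\tau\,:\,l<k\}}$; let $\widetilde Z_i$ denote cycles and $\widetilde H_i$ reduced homology. For every $\mathbf b \in \mathbb N^n$ let linear maps $\partial^{\mathbf b+}_i : \widetilde C_{i-1}K^{\mathbf b}I \to \widetilde C_i K^{\mathbf b}I$ (for all $i$) be given that form a differential, $\partial^{\mathbf b+}\partial^{\mathbf b+} = 0$, and satisfy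 $$\partial^{\mathbf b}\partial^{\mathbf b+}\partial^{\mathbf b} = \partial^{\mathbf b}, \qquad \partial^{\mathbf b+}\partial^{\mathbf b}\partial^{\mathbf b+} = \partial^{\mathbf b+}.$$ For $\mathbf a,\mathbf b \in \mathbb N^n$ let $\Lambda(\mathbf a,\mathbf b)$ be the set of saturated decreasing lattice paths $\mathbf b = \mathbf b_0, \mathbf b_1,\dots,\mathbf b_\ell = \mathbf a$ with $\ell \ge 1$ steps, where each $\lambda_j = \mathbf b_{j-1}-\mathbf b_j$ is a standard basis vector (also identified with its index in $\{1,\dots,n\}$). Let $d_1^{\lambda_j}$ take a face $\tau$ of $K^{\mathbf b_{j-1}}I$ to $0$ if $\lambda_j \notin \tau$ and to $(-1)^{\tau\smallsetminus\lambda_j\subset\tau}\,\tau\smallsetminus\lambda_j$, a face of $K^{\mathbf b_j}I$, if $\lambda_j\in\tau$. For $i \ge 0$ define, on $\widetilde C_i K^{\mathbf b}I$, $$D^{\mathbf a\mathbf b} = \sum_{\lambda\in\Lambda(\mathbf a,\mathbf b)} (1-\partial^{\mathbf a+}_i\partial^{\mathbf a}_i)\, d_1^{\lambda_\ell}\, \bigl(\partial_i^{\mathbf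 b_{\ell-1}+} d_1^{\lambda_{\ell-1}}\bigr)\cdots\bigl(\partial_i^{\mathbf b_1+} d_1^{\lambda_1}\bigr)\,(1-\partial^{\mathbf b}_{i+1}\partial^{\mathbf b+}_{i+1}).$$ Then $D^{\mathbf a\mathbf b}$ maps $\widetilde Z_iK^{\mathbf b}I$ to $\widetilde Z_{i-1}K^{\mathbf a}I$ and vanishes on boundaries, so that it induces a map $\widetilde H_{i-1}K^{\mathbf a}I \leftarrow \widetilde H_iK^{\mathbf b}I$. The free $\mathbb N^n$-graded modules $$F_i = \bigoplus_{\mathbf b\in\mathbb N^n} \widetilde H_{i-1}K^{\mathbf b}I \otimes_{\Bbbk} \Bbbk[\mathbf x](-\mathbf b) \qquad (i \ge 0),$$ with the $\Bbbk[\mathbf x]$-linear differentials $F_{i+1} \to F_i$ whose component $\widetilde H_{i-1}K^{\mathbf a}I\otimes\Bbbk[\mathbf x](-\mathbf a) \leftarrow \widetilde H_iK^{\mathbf b}I\otimes\Bbbk[\mathbf x](-\mathbf b)$ is induced in degree $\mathbf b$ by $D^{\mathbf a\mathbf b}$, that is, sends $h \otimes p$ to $D^{\mathbf a\mathbf b}h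 \otimes \mathbf x^{\mathbf b-\mathbf a}p$ (and is $0$ unless $\mathbf a \prec \mathbf b$), form an $\mathbb N^n$-graded minimal free resolution of $I$: the $F_i$ are finitely generated and free, the differentials preserve $\mathbb N^n$-degree, there is a degree-preserving surjection $F_0 \to I$ with which the complex $\cdots\to F_1\to F_0\to I\to 0$ is exact, and the image of $F_{i+1}$ in $F_i$ lies in $\langle x_1,\dots,x_n\rangle F_i$ for every $i \ge 0$. -/

import Mathlib

open scoped TensorProduct DirectSum

noncomputable section

namespace KoszulSplit

variable {k : Type*} [Field k] {n : ℕ}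

/-- A monomial ideal: an ideal generated by a set of monomials. -/
def IsMonomialIdeal (I : Ideal (MvPolynomial (Fin n) k)) : Prop :=
  ∃ S : Set (Fin n →₀ ℕ), I = Ideal.span ((fun u => MvPolynomial.monomial u (1 : k)) '' S)

/-- The squarefree exponent vector in `{0,1}^n` of a subset `τ` of `{1,…,n}`. -/
def indicator (τ : Finset (Fin n)) : Fin n →₀ ℕ := ∑ i ∈ τ, Finsupp.single i 1

/-- The faces of the upper Koszul simplicial complex `K^b I`: the subsets `τ` with
`x^(b-τ) ∈ I`; a vector `b - τ` with a negative entry is not an exponent of a monomial of `I`. -/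
def koszulFaces (I : Ideal (MvPolynomial (Fin n) k)) (b : Fin n →₀ ℕ) : Set (Finset (Fin n)) :=
  {τ | indicator τ ≤ b ∧ MvPolynomial.monomial (b - indicator τ) (1 : k) ∈ I}

/-- The map `τ ↦ (-1)^(τ∖i ⊂ τ) (τ∖i)` if `i ∈ τ`, and `τ ↦ 0` if `i ∉ τ`, on the vector space
with basis all subsets of `{1,…,n}`. The sign is the usual one: the parity of the position of `i`
in the increasing list of elements of `τ`. -/
def removeVertex (i : Fin n) : (Finset (Fin n) →₀ k) →ₗ[k] (Finset (Fin n) →₀ k) :=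
  Finsupp.lsum k fun τ => LinearMap.toSpanSingleton k _
    (if i ∈ τ then Finsupp.single (τ.erase i) ((-1 : k) ^ (τ.filter (· < i)).card) else 0)

/-- The reduced simplicial boundary operator on the span of all subsets of `{1,…,n}`. -/
def boundary : (Finset (Fin n) →₀ k) →ₗ[k] (Finset (Fin n) →₀ k) := ∑ i, removeVertex i

/-- The reduced chains of `K^b I` of all dimensions together: the span of the faces. -/
def chains (I : Ideal (MvPolynomial (Fin n) k)) (b : Fin n →₀ ℕ) : Type _ :=
  Finsupp.supported k k (koszulFaces I b)

instance (I : Ideal (MvPolynomial (Fin n) k)) (b : Fin n →₀ ℕ) : AddCommGroup (chains I b) :=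
  inferInstanceAs (AddCommGroup (Finsupp.supported k k (koszulFaces I b)))

instance (I : Ideal (MvPolynomial (Fin n) k)) (b : Fin n →₀ ℕ) : Module k (chains I b) :=
  inferInstanceAs (Module k (Finsupp.supported k k (koszulFaces I b)))

/-- The inclusion of the chains of `K^b I` into the span of all subsets of `{1,…,n}`. -/
def inclusion (I : Ideal (MvPolynomial (Fin n) k)) (b : Fin n →₀ ℕ) :
    chains I b →ₗ[k] (Finset (Fin n) →₀ k) :=
  (Finsupp.supported k k (koszulFaces I b)).subtype

/-- The reduced chains of `K^b I` spanned by the faces with `j` vertices, that is, of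
dimension `j - 1`; the case `j = 0` is the span of the empty face. -/
def chainsOfCard (I : Ideal (MvPolynomial (Fin n) k)) (b : Fin n →₀ ℕ) (j : ℕ) :
    Submodule k (chains I b) :=
  (Finsupp.supported k k {τ : Finset (Fin n) | τ.card = j}).comap (inclusion I b)

theorem removeVertex_single (i : Fin n) (τ : Finset (Fin n)) (r : k) :
    removeVertex i (Finsupp.single τ r) =
      if i ∈ τ then Finsupp.single (τ.erase i) (r * (-1 : k) ^ (τ.filter (· < i)).card) else 0 := by
  unfold removeVertex
  rw [Finsupp.lsum_single, LinearMap.toSpanSingleton_apply]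
  split_ifs <;> simp

theorem removeVertex_mem_supported {s t : Set (Finset (Fin n))} {i : Fin n}
    (h : ∀ τ ∈ s, i ∈ τ → τ.erase i ∈ t) {c : Finset (Fin n) →₀ k}
    (hc : c ∈ Finsupp.supported k k s) : removeVertex i c ∈ Finsupp.supported k k t := by
  rw [Finsupp.supported_eq_span_single] at hc
  induction hc using Submodule.span_induction with
  | mem x hx =>
    obtain ⟨τ, hτ, rfl⟩ := hx
    dsimp only
    rw [removeVertex_single]
    split_ifs with hi
    · exact Finsupp.single_mem_supported k _ (h τ hτ hi)
    · exact zero_mem _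
  | zero => simp
  | add x y _ _ hx hy => rw [map_add]; exact add_mem hx hy
  | smul r x _ hx => rw [map_smul]; exact Submodule.smul_mem _ _ hx

theorem indicator_erase {i : Fin n} {τ : Finset (Fin n)} (hi : i ∈ τ) :
    indicator τ = indicator (τ.erase i) + Finsupp.single i 1 := by
  unfold indicator
  rw [add_comm, Finset.add_sum_erase τ (fun i => Finsupp.single i 1) hi]

theorem erase_mem_koszulFaces (I : Ideal (MvPolynomial (Fin n) k)) (b : Fin n →₀ ℕ) {i : Fin n}
    {τ : Finset (Fin n)} (hτ : τ ∈ koszulFaces I b) (hi : i ∈ τ) :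
    τ.erase i ∈ koszulFaces I b := by
  obtain ⟨h1, h2⟩ := hτ
  rw [indicator_erase hi] at h1 h2
  have h3 : indicator (τ.erase i) ≤ b := le_trans le_self_add h1
  refine ⟨h3, ?_⟩
  have h4 : b - indicator (τ.erase i) =
      Finsupp.single i 1 + (b - (indicator (τ.erase i) + Finsupp.single i 1)) := by
    rw [← tsub_tsub, add_tsub_cancel_of_le]
    rw [le_tsub_iff_left h3]
    exact h1
  rw [h4, ← one_mul (1 : k), ← MvPolynomial.monomial_mul]
  exact I.mul_mem_left _ (by simpa using h2)

theorem erase_mem_koszulFaces_step (I : Ideal (MvPolynomial (Fin n) k)) (c : Fin n →₀ ℕ)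
    {i : Fin n} {τ : Finset (Fin n)} (hτ : τ ∈ koszulFaces I (c + Finsupp.single i 1))
    (hi : i ∈ τ) : τ.erase i ∈ koszulFaces I c := by
  obtain ⟨h1, h2⟩ := hτ
  rw [indicator_erase hi] at h1 h2
  refine ⟨le_of_add_le_add_right h1, ?_⟩
  rwa [add_tsub_add_eq_tsub_right] at h2

/-- The differential `∂^b` of the reduced chain complex of `K^b I`. -/
def koszulBoundary (I : Ideal (MvPolynomial (Fin n) k)) (b : Fin n →₀ ℕ) :
    chains I b →ₗ[k] chains I b :=
  boundary.restrict fun c hc => by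
    rw [boundary, LinearMap.sum_apply]
    exact sum_mem fun i _ =>
      removeVertex_mem_supported (fun τ hτ hi => erase_mem_koszulFaces I b hτ hi) hc

/-- The map `d₁^i` from the chains of `K^(c+e_i) I` to the chains of `K^c I`. -/
def stepDown (I : Ideal (MvPolynomial (Fin n) k)) (c : Fin n →₀ ℕ) (i : Fin n) :
    chains I (c + Finsupp.single i 1) →ₗ[k] chains I c :=
  (removeVertex i).restrict fun _ hx =>
    removeVertex_mem_supported (fun _ hτ hi => erase_mem_koszulFaces_step I c hτ hi) hx

theorem removeVertex_card {i : Fin n} {j : ℕ} {x : Finset (Fin n) →₀ k}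
    (hx : x ∈ Finsupp.supported k k {τ : Finset (Fin n) | τ.card = j + 1}) :
    removeVertex i x ∈ Finsupp.supported k k {τ : Finset (Fin n) | τ.card = j} :=
  removeVertex_mem_supported (fun τ hτ hi => by
    rw [Set.mem_ofPred_eq] at hτ ⊢
    rw [Finset.card_erase_of_mem hi, hτ]; rfl) hx

theorem koszulBoundary_card (I : Ideal (MvPolynomial (Fin n) k)) (b : Fin n →₀ ℕ) {j : ℕ}
    {x : chains I b} (hx : x ∈ chainsOfCard I b (j + 1)) :
    koszulBoundary I b x ∈ chainsOfCard I b j := by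
  change boundary (inclusion I b x) ∈ Finsupp.supported k k _
  rw [boundary, LinearMap.sum_apply]
  exact sum_mem fun i _ => removeVertex_card hx

theorem stepDown_card (I : Ideal (MvPolynomial (Fin n) k)) (c : Fin n →₀ ℕ) (i : Fin n) {j : ℕ}
    {x : chains I (c + Finsupp.single i 1)} (hx : x ∈ chainsOfCard I _ (j + 1)) :
    stepDown I c i x ∈ chainsOfCard I c j :=
  removeVertex_card hx

/-- The reduced cycles of `K^b I` of dimension `j - 1`. -/
def cycles (I : Ideal (MvPolynomial (Fin n) k)) (b : Fin n →₀ ℕ) (j : ℕ) :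
    Submodule k (chains I b) :=
  chainsOfCard I b j ⊓ LinearMap.ker (koszulBoundary I b)

/-- The reduced boundaries of `K^b I` of dimension `j - 1`. -/
def boundaries (I : Ideal (MvPolynomial (Fin n) k)) (b : Fin n →₀ ℕ) (j : ℕ) :
    Submodule k (chains I b) :=
  (chainsOfCard I b (j + 1)).map (koszulBoundary I b)

/-- The reduced homology `H̃_(j-1)(K^b I; k)`, as cycles modulo boundaries. -/
abbrev homology (I : Ideal (MvPolynomial (Fin n) k)) (b : Fin n →₀ ℕ) (j : ℕ) : Type _ :=
  cycles I b j ⧸ (boundaries I b j).comap (cycles I b j).subtype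

/-- A splitting `∂⁺` of the differential `∂` of the reduced chain complex of `K^b I`: a linear map
raising dimension by one, that is itself a differential, with `∂∂⁺∂ = ∂` and `∂⁺∂∂⁺ = ∂⁺`. -/
structure Splitting (I : Ideal (MvPolynomial (Fin n) k)) (b : Fin n →₀ ℕ) where
  up : chains I b →ₗ[k] chains I b
  up_mem : ∀ (j : ℕ), ∀ x ∈ chainsOfCard I b j, up x ∈ chainsOfCard I b (j + 1)
  up_up : up ∘ₗ up = 0
  del_up_del : koszulBoundary I b ∘ₗ up ∘ₗ koszulBoundary I b = koszulBoundary I b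
  up_del_up : up ∘ₗ koszulBoundary I b ∘ₗ up = up

/-- `LatticePath a b` is the type of saturated decreasing lattice paths in `ℕ^n`, with at least
one step, from `b` to `a`: `step i` is the one-step path `a + e_i, a`, and `cons i p` is the path
that first steps from `c + e_i` to `c` and then follows `p` from `c` to `a`. -/
inductive LatticePath (a : Fin n →₀ ℕ) : (Fin n →₀ ℕ) → Type
  | step (i : Fin n) : LatticePath a (a + Finsupp.single i 1)
  | cons {c : Fin n →₀ ℕ} (i : Fin n) (p : LatticePath a c) :
      LatticePath a (c + Finsupp.single i 1)

namespace LatticePath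

/-- The directions of the steps of a path, starting at the upper end. -/
def directions {a : Fin n →₀ ℕ} : {b : Fin n →₀ ℕ} → LatticePath a b → List (Fin n)
  | _, step i => [i]
  | _, cons i p => i :: p.directions

theorem sum_directions {a b : Fin n →₀ ℕ} (p : LatticePath a b) :
    b = a + (p.directions.map fun i => Finsupp.single i 1).sum := by
  induction p with
  | step i => simp [directions]
  | cons i p ih =>
    rw [directions, List.map_cons, List.sum_cons, add_left_comm, ← ih, add_comm]

theorem directions_ne_nil {a b : Fin n →₀ ℕ} (p : LatticePath a b) : p.directions ≠ [] := by
  cases p <;> simp [directions]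

theorem heq_of_directions {a b : Fin n →₀ ℕ} (p : LatticePath a b) :
    ∀ {b' : Fin n →₀ ℕ} (q : LatticePath a b'), b = b' → p.directions = q.directions → p ≍ q := by
  induction p with
  | step i =>
    intro b' q hb h
    cases q with
    | step j =>
      simp only [directions, List.cons.injEq, and_true] at h
      subst h
      rfl
    | cons j q =>
      simp only [directions, List.cons.injEq] at h
      exact absurd h.2.symm q.directions_ne_nil
  | cons i p ih =>
    intro b' q hb h
    cases q with
    | step j =>
      simp only [directions, List.cons.injEq] at h
      exact absurd h.2 p.directions_ne_nil
    | cons j q =>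
      simp only [directions, List.cons.injEq] at h
      obtain ⟨rfl, h⟩ := h
      have hc := add_right_cancel hb
      subst hc
      rw [eq_of_heq (ih q rfl h)]

theorem length_directions {a b : Fin n →₀ ℕ} (p : LatticePath a b) :
    p.directions.length ≤ b.degree := by
  induction p with
  | step i => simp [directions]
  | cons i p ih => simpa [directions] using ih

instance (a b : Fin n →₀ ℕ) : Finite (LatticePath a b) := by
  have : Finite {l : List (Fin n) | l.length ≤ b.degree} :=
    (List.finite_length_le (Fin n) b.degree).to_subtype
  refine Finite.of_injective
    (fun p : LatticePath a b =>
      (⟨p.directions, p.length_directions⟩ : {l : List (Fin n) | l.length ≤ b.degree})) ?_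
  intro p q h
  exact eq_of_heq (heq_of_directions p q rfl (congrArg Subtype.val h))

instance (a b : Fin n →₀ ℕ) : Fintype (LatticePath a b) := Fintype.ofFinite _

/-- For the path `b = b₀, b₁, …, b_ℓ = a` with steps `λ₁, …, λ_ℓ`, the composite
`d₁^{λ_ℓ} ∂^{b_{ℓ-1}+} d₁^{λ_{ℓ-1}} ⋯ ∂^{b_1+} d₁^{λ_1}` from the chains of `K^b I` to the chains
of `K^a I`. -/
def transport {I : Ideal (MvPolynomial (Fin n) k)} (s : ∀ b, Splitting I b) {a : Fin n →₀ ℕ} :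
    {b : Fin n →₀ ℕ} → LatticePath a b → (chains I b →ₗ[k] chains I a)
  | _, step i => stepDown I a i
  | _, cons (c := c) i p => p.transport s ∘ₗ (s c).up ∘ₗ stepDown I c i

theorem transport_card {I : Ideal (MvPolynomial (Fin n) k)} (s : ∀ b, Splitting I b)
    {a b : Fin n →₀ ℕ} (p : LatticePath a b) {j : ℕ} {x : chains I b}
    (hx : x ∈ chainsOfCard I b (j + 1)) : p.transport s x ∈ chainsOfCard I a j := by
  induction p with
  | step i => exact stepDown_card I _ i hx
  | cons i p ih => exact ih ((s _).up_mem _ _ (stepDown_card I _ i hx))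

end LatticePath

/-- The chain-level map
`D = ∑_λ (1 - ∂^{a+} ∂^a) d₁^{λ_ℓ} (∏_j ∂^{b_j+} d₁^{λ_j}) (1 - ∂^b ∂^{b+})`,
summed over the saturated decreasing lattice paths `λ` from `b` to `a`. -/
def pathSum {I : Ideal (MvPolynomial (Fin n) k)} (s : ∀ b, Splitting I b) (a b : Fin n →₀ ℕ) :
    chains I b →ₗ[k] chains I a :=
  ∑ p : LatticePath a b,
    (LinearMap.id - (s a).up ∘ₗ koszulBoundary I a) ∘ₗ p.transport s ∘ₗ
      (LinearMap.id - koszulBoundary I b ∘ₗ (s b).up)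

theorem pathSum_mem_cycles {I : Ideal (MvPolynomial (Fin n) k)} (s : ∀ b, Splitting I b)
    (a b : Fin n →₀ ℕ) (j : ℕ) (x : chains I b) (hx : x ∈ cycles I b (j + 1)) :
    pathSum s a b x ∈ cycles I a j := by
  rw [pathSum, LinearMap.sum_apply]
  refine sum_mem fun p _ => ?_
  have h1 : x - koszulBoundary I b ((s b).up x) ∈ chainsOfCard I b (j + 1) :=
    sub_mem hx.1 (koszulBoundary_card I b ((s b).up_mem _ _ hx.1))
  have h2 := p.transport_card s h1
  refine ⟨?_, ?_⟩
  · change p.transport s _ - (s a).up (koszulBoundary I a (p.transport s _)) ∈ chainsOfCard I a j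
    refine sub_mem h2 ?_
    cases j with
    | zero =>
      have h3 : koszulBoundary I a (p.transport s (x - koszulBoundary I b ((s b).up x))) = 0 := by
        apply Subtype.ext
        change boundary (inclusion I a
          (p.transport s (x - koszulBoundary I b ((s b).up x)))) = 0
        rw [boundary, LinearMap.sum_apply]
        refine Finset.sum_eq_zero fun i _ => ?_
        have h5 := removeVertex_mem_supported (i := i)
          (t := (∅ : Set (Finset (Fin n)))) (fun τ hτ hi => by
            rw [Set.mem_ofPred_eq, Finset.card_eq_zero] at hτ
            simp [hτ] at hi) h2
        simpa using h5
      change (s a).up (koszulBoundary I a (p.transport s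
        (x - koszulBoundary I b ((s b).up x)))) ∈ chainsOfCard I a 0
      rw [h3, map_zero]
      exact zero_mem _
    | succ j => exact (s a).up_mem _ _ (koszulBoundary_card I a h2)
  · refine LinearMap.mem_ker.2 ?_
    rw [LinearMap.comp_apply, LinearMap.sub_apply, map_sub,
      LinearMap.id_apply, sub_eq_zero]
    exact (LinearMap.congr_fun (s a).del_up_del _).symm

theorem pathSum_boundary {I : Ideal (MvPolynomial (Fin n) k)} (s : ∀ b, Splitting I b)
    (a b : Fin n →₀ ℕ) (x : chains I b) : pathSum s a b (koszulBoundary I b x) = 0 := by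
  rw [pathSum, LinearMap.sum_apply]
  refine Finset.sum_eq_zero fun p _ => ?_
  have h : (LinearMap.id - koszulBoundary I b ∘ₗ (s b).up : chains I b →ₗ[k] chains I b)
      (koszulBoundary I b x) = 0 := by
    rw [LinearMap.sub_apply, LinearMap.id_apply, sub_eq_zero]
    exact (LinearMap.congr_fun (s b).del_up_del x).symm
  rw [LinearMap.comp_apply, LinearMap.comp_apply, h, map_zero, map_zero]

/-- The map `H̃_(j-1)(K^a I) ← H̃_j(K^b I)` that sends the class of a cycle `z` to the class
of the cycle `D z`. -/
def homologyMap {I : Ideal (MvPolynomial (Fin n) k)} (s : ∀ b, Splitting I b)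
    (a b : Fin n →₀ ℕ) (j : ℕ) : homology I b (j + 1) →ₗ[k] homology I a j :=
  Submodule.mapQ _ _ ((pathSum s a b).restrict (pathSum_mem_cycles s a b j)) fun z hz => by
    obtain ⟨x, -, hx⟩ := hz
    change pathSum s a b z.1 ∈ boundaries I a j
    have hx' : koszulBoundary I b x = z.1 := hx
    rw [← hx', pathSum_boundary]
    exact zero_mem _

/-- The free module `⨁_b H̃_(i-1)(K^b I) ⊗ k[x](-b)` in homological stage `i`. -/
abbrev stage (I : Ideal (MvPolynomial (Fin n) k)) (i : ℕ) : Type _ :=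
  ⨁ b : Fin n →₀ ℕ, MvPolynomial (Fin n) k ⊗[k] homology I b i

/-- The `ℕ^n`-degree `c` part of `⨁_b H̃_(i-1)(K^b I) ⊗ k[x](-b)`: the span of the elements
`x^u ⊗ h` in the summand of index `b` with `b + u = c`. -/
def gradedPiece (I : Ideal (MvPolynomial (Fin n) k)) (i : ℕ) (c : Fin n →₀ ℕ) :
    Submodule k (stage I i) :=
  Submodule.span k {y | ∃ (b u : Fin n →₀ ℕ) (h : homology I b i), b + u = c ∧
    y = DirectSum.lof (MvPolynomial (Fin n) k) (Fin n →₀ ℕ)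
      (fun b => MvPolynomial (Fin n) k ⊗[k] homology I b i) b
      (MvPolynomial.monomial u (1 : k) ⊗ₜ[k] h)}

/-- The map `H ⊗ k[x](-b) → H' ⊗ k[x](-a)` of `ℕ^n`-graded free modules induced by a linear map
`f : H → H'` in degree `b`: it sends `p ⊗ h` to `x^(b-a) p ⊗ f h`. -/
def inducedMap {H H' : Type*} [AddCommGroup H] [Module k H] [AddCommGroup H'] [Module k H']
    (a b : Fin n →₀ ℕ) (f : H →ₗ[k] H') :
    MvPolynomial (Fin n) k ⊗[k] H →ₗ[MvPolynomial (Fin n) k] MvPolynomial (Fin n) k ⊗[k] H' :=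
  MvPolynomial.monomial (b - a) (1 : k) • f.baseChange (MvPolynomial (Fin n) k)

/-- The complex `⋯ → F 1 → F 0` with differentials `D`, together with `ε : F 0 → M`, is a minimal
free resolution of `M`, where `m` is the maximal ideal relative to which minimality is meant. -/
structure IsMinimalFreeResolution {R : Type*} [CommRing R] (m : Ideal R) {M : Type*}
    [AddCommGroup M] [Module R M] (F : ℕ → Type*) [∀ i, AddCommGroup (F i)] [∀ i, Module R (F i)]
    (D : ∀ i, F (i + 1) →ₗ[R] F i) (ε : F 0 →ₗ[R] M) : Prop where
  free : ∀ i, Module.Free R (F i)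
  finite : ∀ i, Module.Finite R (F i)
  exact : ∀ i, Function.Exact (D (i + 1)) (D i)
  exact_augmentation : Function.Exact (D 0) ε
  surjective : Function.Surjective ε
  minimal : ∀ i, LinearMap.range (D i) ≤ m • (⊤ : Submodule R (F i))

end KoszulSplit

end

/-!
For `c ∈ ℕ^n` take all the chains of the `K^b I` with `b ≤ c` together, with the differential
`∂ - d₁`, where `d₁` is the sum of the `d₁^i`. This is the chain complex of the cubical complex of
all cubes `[b - τ, b]` with `b ≤ c` and `x^(b-τ) ∈ I`. The lower corners of these cubes are the
exponents of the monomials of `I` that divide `x^c`, so the complex is empty or can be contracted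
to the vertex `c`: its homology is the part of `I` of degree `c`, in homological degree `0`.

The splittings `∂^{b+}` contract each `K^b I` to its harmonic chains, which represent its homology.
By the homological perturbation lemma they also contract the complex with differential `∂ - d₁`,
to the same harmonic chains with the differential `∑ m, d₁ (∂⁺ d₁)^m` up to sign. The sum is finite
because `d₁` decreases `b`; expanded, it is the sum over lattice paths `D^{ab}`. So the part of
degree `c` of the asserted resolution is exact. It is minimal because a path has at least one step,
and the `F_i` are finitely generated because `K^b I` is a cone, hence acyclic, as soon as `x^b`
does not divide the least common multiple of a finite set of monomial generators.
-/

open scoped TensorProduct DirectSum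

noncomputable section

namespace KoszulSplit

section VertexSign

variable {k : Type*} [CommRing k] {n : ℕ}

/-- The sign `(-1)^(τ∖i ⊂ τ)`, the parity of the position of `i` in `τ`. -/
def vertexSign (k : Type*) [CommRing k] (i : Fin n) (τ : Finset (Fin n)) : k :=
  (-1) ^ (τ.filter (· < i)).card

theorem vertexSign_mul_self (i : Fin n) (τ : Finset (Fin n)) :
    vertexSign k i τ * vertexSign k i τ = 1 := by
  rw [vertexSign, ← mul_pow, neg_one_mul, neg_neg, one_pow]

theorem vertexSign_insert_self (i : Fin n) (τ : Finset (Fin n)) :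
    vertexSign k i (insert i τ) = vertexSign k i τ := by
  rw [vertexSign, Finset.filter_insert, if_neg (lt_irrefl i), vertexSign]

theorem vertexSign_erase_self (i : Fin n) (τ : Finset (Fin n)) :
    vertexSign k i (τ.erase i) = vertexSign k i τ := by
  rw [vertexSign, Finset.filter_erase, Finset.erase_eq_of_notMem (by simp), vertexSign]

theorem vertexSign_insert {i j : Fin n} {τ : Finset (Fin n)} (hi : i ∉ τ) :
    vertexSign k j (insert i τ) = (if i < j then -1 else 1) * vertexSign k j τ := by
  rw [vertexSign, Finset.filter_insert, vertexSign]
  split_ifs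
  · rw [Finset.card_insert_of_notMem (by simp [hi]), pow_succ, mul_comm]
  · rw [one_mul]

theorem vertexSign_insert_mul_vertexSign {i j : Fin n} (hij : i ≠ j) {τ : Finset (Fin n)}
    (hi : i ∉ τ) (hj : j ∉ τ) :
    vertexSign k i (insert j τ) * vertexSign k j τ =
      -(vertexSign k j (insert i τ) * vertexSign k i τ) := by
  rw [vertexSign_insert hi, vertexSign_insert hj]
  rcases hij.lt_or_gt with h | h <;> simp [h, h.not_gt, mul_comm]

end VertexSign

section Vertex

variable {k : Type*} [Field k] {n : ℕ}

/-- The map `τ ↦ (-1)^(τ ⊂ τ∪i) (τ∪i)` if `i ∉ τ`, and `τ ↦ 0` if `i ∈ τ`: the contraction of the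
full simplex to the vertex `i`. -/
def addVertex (i : Fin n) : (Finset (Fin n) →₀ k) →ₗ[k] (Finset (Fin n) →₀ k) :=
  Finsupp.lsum k fun τ => LinearMap.toSpanSingleton k _
    (if i ∈ τ then 0 else Finsupp.single (insert i τ) (vertexSign k i τ))

theorem removeVertex_apply (i : Fin n) (x : Finset (Fin n) →₀ k) (τ : Finset (Fin n)) :
    removeVertex i x τ = if i ∈ τ then 0 else vertexSign k i τ * x (insert i τ) := by
  induction x using Finsupp.induction_linear with
  | zero => simp
  | add x y hx hy => rw [map_add, Finsupp.add_apply, hx, hy]; split_ifs <;> simp [mul_add]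
  | single σ r =>
    have hσ : i ∈ σ → (σ.erase i = τ ↔ i ∉ τ ∧ σ = insert i τ) := by grind
    rw [removeVertex_single, ← vertexSign, ← vertexSign_erase_self]
    split_ifs <;> grind

theorem addVertex_apply (i : Fin n) (x : Finset (Fin n) →₀ k) (τ : Finset (Fin n)) :
    addVertex i x τ = if i ∈ τ then vertexSign k i τ * x (τ.erase i) else 0 := by
  induction x using Finsupp.induction_linear with
  | zero => simp
  | add x y hx hy => rw [map_add, Finsupp.add_apply, hx, hy]; split_ifs <;> simp [mul_add]
  | single σ r =>
    rw [addVertex, Finsupp.lsum_single, LinearMap.toSpanSingleton_apply,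
      ← vertexSign_insert_self]
    have hσ : i ∉ σ → (insert i σ = τ ↔ i ∈ τ ∧ σ = τ.erase i) := by grind
    split_ifs <;> grind [smul_eq_mul, Finsupp.smul_apply]

theorem removeVertex_removeVertex_self (i : Fin n) (x : Finset (Fin n) →₀ k) :
    removeVertex i (removeVertex i x) = 0 := by
  ext τ
  simp [removeVertex_apply]

theorem removeVertex_anticomm (i j : Fin n) (x : Finset (Fin n) →₀ k) :
    removeVertex i (removeVertex j x) + removeVertex j (removeVertex i x) = 0 := by
  rcases eq_or_ne i j with rfl | hij
  · simp [removeVertex_removeVertex_self]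
  ext τ
  by_cases hi : i ∈ τ
  · simp [removeVertex_apply, hi]
  by_cases hj : j ∈ τ
  · simp [removeVertex_apply, hj]
  have hsign := vertexSign_insert_mul_vertexSign (k := k) hij hi hj
  simp only [Finsupp.add_apply, Finsupp.zero_apply, removeVertex_apply, Finset.mem_insert, hi, hj,
    hij, hij.symm, or_self, if_false, Finset.insert_comm i j]
  linear_combination x (insert j (insert i τ)) * hsign

theorem removeVertex_addVertex_self (i : Fin n) (x : Finset (Fin n) →₀ k) :
    removeVertex i (addVertex i x) + addVertex i (removeVertex i x) = x := by
  ext τ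
  by_cases hi : i ∈ τ
  · simp [removeVertex_apply, addVertex_apply, hi, vertexSign_erase_self, ← mul_assoc,
      vertexSign_mul_self]
  · simp [removeVertex_apply, addVertex_apply, hi, vertexSign_insert_self, ← mul_assoc,
      vertexSign_mul_self]

theorem removeVertex_addVertex {i j : Fin n} (hij : i ≠ j) (x : Finset (Fin n) →₀ k) :
    removeVertex i (addVertex j x) + addVertex j (removeVertex i x) = 0 := by
  ext τ
  by_cases hi : i ∈ τ
  · simp [removeVertex_apply, addVertex_apply, hi, hij]
  by_cases hj : j ∈ τ
  · obtain ⟨σ, hσ, rfl⟩ : ∃ σ, j ∉ σ ∧ insert j σ = τ :=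
      ⟨τ.erase j, Finset.notMem_erase j τ, Finset.insert_erase hj⟩
    have hiσ : i ∉ σ := fun h => hi (Finset.mem_insert_of_mem h)
    have hsign := vertexSign_insert_mul_vertexSign (k := k) hij hiσ hσ
    have hsq := vertexSign_mul_self (k := k) j σ
    have hsq' := vertexSign_mul_self (k := k) j (insert i σ)
    have herase : (insert j (insert i σ)).erase j = insert i σ :=
      Finset.erase_insert (by simp [hij.symm, hσ])
    simp only [Finsupp.add_apply, Finsupp.zero_apply, removeVertex_apply, addVertex_apply, hi, hiσ,
      hσ, Finset.mem_insert, Finset.erase_insert, vertexSign_insert_self, herase,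
      true_or, if_true, if_false, not_false_eq_true, Finset.insert_comm i j]
    linear_combination x (insert i σ) * (vertexSign k j σ * vertexSign k j (insert i σ) * hsign -
      vertexSign k i (insert j σ) * vertexSign k j (insert i σ) * hsq -
      vertexSign k j σ * vertexSign k i σ * hsq')
  · simp [removeVertex_apply, addVertex_apply, hi, hj, hij.symm]

theorem boundary_apply (x : Finset (Fin n) →₀ k) : boundary x = ∑ i, removeVertex i x := by
  rw [boundary, LinearMap.sum_apply]

theorem sum_sum_eq_zero_of_antisymm {ι M : Type*} [Fintype ι] [AddCommGroup M] (f : ι → ι → M)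
    (h : ∀ i j, f i j + f j i = 0) (h' : ∀ i, f i i = 0) : ∑ i, ∑ j, f i j = 0 := by
  classical
  rw [← Finset.sum_product']
  refine Finset.sum_involution (fun p _ => (p.2, p.1)) (fun p _ => h _ _) ?_ (by simp) (by simp)
  rintro ⟨i, j⟩ - hp e
  obtain rfl : j = i := congrArg Prod.fst e
  exact hp (h' _)

theorem boundary_removeVertex (i : Fin n) (x : Finset (Fin n) →₀ k) :
    boundary (removeVertex i x) + removeVertex i (boundary x) = 0 := by
  rw [boundary_apply, boundary_apply x, map_sum (removeVertex i), ← Finset.sum_add_distrib]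
  exact Finset.sum_eq_zero fun j _ => removeVertex_anticomm j i x

theorem boundary_boundary (x : Finset (Fin n) →₀ k) : boundary (boundary x) = 0 := by
  simp only [boundary_apply, map_sum]
  exact sum_sum_eq_zero_of_antisymm _ (fun i j => removeVertex_anticomm j i x)
    fun i => removeVertex_removeVertex_self i x

theorem boundary_addVertex (i : Fin n) (x : Finset (Fin n) →₀ k) :
    boundary (addVertex i x) + addVertex i (boundary x) = x := by
  rw [boundary_apply, boundary_apply x, map_sum (addVertex i), ← Finset.sum_add_distrib,
    Finset.sum_eq_single i (fun j _ hj => removeVertex_addVertex hj x) (by simp),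
    removeVertex_addVertex_self]

theorem removeVertex_eq_zero_of_card_eq_zero (i : Fin n) {x : Finset (Fin n) →₀ k}
    (hx : x ∈ Finsupp.supported k k {τ : Finset (Fin n) | τ.card = 0}) :
    removeVertex i x = 0 := by
  have h : removeVertex i x ∈ Finsupp.supported k k ∅ :=
    removeVertex_mem_supported (fun τ hτ hi => by
      rw [Set.mem_ofPred_eq, Finset.card_eq_zero] at hτ
      simp [hτ] at hi) hx
  simpa using h

theorem addVertex_mem_supported {s t : Set (Finset (Fin n))} {i : Fin n}
    (h : ∀ τ ∈ s, i ∉ τ → insert i τ ∈ t) {x : Finset (Fin n) →₀ k}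
    (hx : x ∈ Finsupp.supported k k s) : addVertex i x ∈ Finsupp.supported k k t := by
  rw [Finsupp.mem_supported'] at hx ⊢
  intro τ hτ
  rw [addVertex_apply]
  split_ifs with hi
  · rw [hx _ fun hs => hτ ?_, mul_zero]
    rw [← Finset.insert_erase hi]
    exact h _ hs (Finset.notMem_erase i τ)
  · rfl

theorem addVertex_card {i : Fin n} {j : ℕ} {x : Finset (Fin n) →₀ k}
    (hx : x ∈ Finsupp.supported k k {τ : Finset (Fin n) | τ.card = j}) :
    addVertex i x ∈ Finsupp.supported k k {τ : Finset (Fin n) | τ.card = j + 1} :=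
  addVertex_mem_supported (fun τ (hτ : τ.card = j) hi =>
    (Finset.card_insert_of_notMem hi).trans (congrArg (· + 1) hτ)) hx

end Vertex

section Perturbation

variable {A : Type*} [Ring A] {p q h N : A}

theorem sub_mul_sub_self_eq_zero (hp : p * p = 0) (hq : q * q = 0) (hpq : p * q + q * p = 0) :
    (p - q) * (p - q) = 0 := by
  linear_combination (norm := noncomm_ring) hp + hq - hpq

variable (p h) in
/-- A differential `p` and a splitting `h` of it, which is a differential as well. -/
structure IsSplitting : Prop where
  pp : p * p = 0
  hh : h * h = 0
  php : p * h * p = p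
  hph : h * p * h = h

/-- The projection `1 - ∂∂⁺ - ∂⁺∂` to the harmonic part, for a differential `∂ = p` and a splitting
`∂⁺ = h` of it. -/
def harmonicProj (p h : A) : A :=
  1 - p * h - h * p

namespace IsSplitting

theorem p_mul_harmonicProj (H : IsSplitting p h) : p * harmonicProj p h = 0 := by
  rw [harmonicProj]
  linear_combination (norm := noncomm_ring) -H.pp * h - H.php

theorem harmonicProj_mul_p (H : IsSplitting p h) : harmonicProj p h * p = 0 := by
  rw [harmonicProj]
  linear_combination (norm := noncomm_ring) -h * H.pp - H.php

theorem h_mul_harmonicProj (H : IsSplitting p h) : h * harmonicProj p h = 0 := by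
  rw [harmonicProj]
  linear_combination (norm := noncomm_ring) -H.hh * p - H.hph

theorem harmonicProj_mul_h (H : IsSplitting p h) : harmonicProj p h * h = 0 := by
  rw [harmonicProj]
  linear_combination (norm := noncomm_ring) -p * H.hh - H.hph

theorem harmonicProj_mul_self (H : IsSplitting p h) :
    harmonicProj p h * harmonicProj p h = harmonicProj p h := by
  have h1 : harmonicProj p h * harmonicProj p h =
      harmonicProj p h - harmonicProj p h * p * h - harmonicProj p h * h * p := by
    conv_lhs => enter [2]; rw [harmonicProj]
    noncomm_ring
  rw [h1, H.harmonicProj_mul_p, H.harmonicProj_mul_h, zero_mul, zero_mul, sub_zero, sub_zero]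

end IsSplitting

variable (p q h N) in
/-- Data of the homological perturbation lemma: anticommuting differentials `p` and `q`, a
splitting `h` of `p`, and an inverse `N` of `1 - hq`. The perturbed differential is `p - q`. -/
structure IsPerturbation : Prop extends IsSplitting p h where
  qq : q * q = 0
  pq : p * q + q * p = 0
  inv_mul : N * (1 - h * q) = 1
  mul_inv : (1 - h * q) * N = 1

variable (p q h N) in
/-- The retraction to the harmonic part which, together with the restriction of `N` to the harmonic
part, makes the latter homotopy equivalent to the complex with differential `p - q`. -/
def perturbedRetraction : A :=
  harmonicProj p h * (1 + q * N * h)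

namespace IsPerturbation

theorem inv_eq_one_add (H : IsPerturbation p q h N) : N = 1 + h * q * N := by
  linear_combination (norm := noncomm_ring) H.mul_inv

theorem inv_eq_one_add' (H : IsPerturbation p q h N) : N = 1 + N * h * q := by
  linear_combination (norm := noncomm_ring) H.inv_mul

theorem h_mul_inv (H : IsPerturbation p q h N) : h * N = h := by
  have hN := congrArg (h * ·) H.inv_eq_one_add
  linear_combination (norm := noncomm_ring) hN + H.hh * q * N

theorem h_mul_diff_mul_inclusion (H : IsPerturbation p q h N) :
    h * (p - q) * (N * harmonicProj p h) = 0 := by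
  linear_combination (norm := noncomm_ring) h * p * H.inv_eq_one_add * harmonicProj p h +
    h * H.p_mul_harmonicProj + H.hph * q * N * harmonicProj p h

theorem retraction_mul_diff_mul_h (H : IsPerturbation p q h N) :
    perturbedRetraction p q h N * (p - q) * h = 0 := by
  rw [perturbedRetraction]
  linear_combination (norm := noncomm_ring) H.harmonicProj_mul_p * h +
    harmonicProj p h * q * N * H.hph + harmonicProj p h * q * H.inv_eq_one_add' * h

theorem retraction_mul_inclusion (H : IsPerturbation p q h N) :
    perturbedRetraction p q h N * (N * harmonicProj p h) = harmonicProj p h := by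
  rw [perturbedRetraction]
  linear_combination (norm := noncomm_ring) harmonicProj p h * q * N * H.h_mul_inv *
    harmonicProj p h + harmonicProj p h * q * N * H.h_mul_harmonicProj +
    harmonicProj p h * H.inv_eq_one_add * harmonicProj p h +
    H.harmonicProj_mul_h * q * N * harmonicProj p h + H.harmonicProj_mul_self

/-- Multiplied by `1 - hq` on the left and by `1 - qh` on the right, this is an identity between
polynomials in `p`, `q` and `h`. -/
theorem one_sub_inclusion_mul_retraction (H : IsPerturbation p q h N) :
    1 - N * perturbedRetraction p q h N = (p - q) * N * h + N * h * (p - q) := by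
  have mul_inv' : (1 - q * h) * (1 + q * N * h) = 1 := by
    linear_combination (norm := noncomm_ring) q * H.mul_inv * h
  have inv_mul' : (1 + q * N * h) * (1 - q * h) = 1 := by
    linear_combination (norm := noncomm_ring) q * H.inv_mul * h
  have hmul : (1 - h * q) * (1 - N * perturbedRetraction p q h N) * (1 - q * h) =
      (1 - h * q) * ((p - q) * N * h + N * h * (p - q)) * (1 - q * h) := by
    rw [perturbedRetraction, harmonicProj]
    linear_combination (norm := noncomm_ring)
      -(H.mul_inv * (1 - p * h - h * p) * ((1 + q * N * h) * (1 - q * h))) -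
      (1 - p * h - h * p) * inv_mul' - (1 - h * q) * (p - q) * H.inv_mul * h -
      H.mul_inv * h * (p - q) * (1 - q * h) + h * H.pq * h - h * H.qq * h
  have cancel (x : A) : N * ((1 - h * q) * x * (1 - q * h)) * (1 + q * N * h) = x := by
    linear_combination (norm := noncomm_ring)
      H.inv_mul * x * ((1 - q * h) * (1 + q * N * h)) + x * mul_inv'
  rw [← cancel (1 - _), hmul, cancel]

theorem retraction_mul_diff_mul_inclusion (H : IsPerturbation p q h N) :
    perturbedRetraction p q h N * (p - q) * (N * harmonicProj p h) =
      -(harmonicProj p h * q * N * harmonicProj p h) := by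
  rw [perturbedRetraction]
  linear_combination (norm := noncomm_ring) harmonicProj p h * q * N * H.h_mul_diff_mul_inclusion +
    H.harmonicProj_mul_p * N * harmonicProj p h

theorem diff_diff (H : IsPerturbation p q h N) : (p - q) * (p - q) = 0 :=
  sub_mul_sub_self_eq_zero H.pp H.qq H.pq

theorem diff_mul_inclusion (H : IsPerturbation p q h N) :
    (p - q) * (N * harmonicProj p h) =
      -(N * (harmonicProj p h * q * N * harmonicProj p h)) := by
  linear_combination (norm := noncomm_ring)
    H.one_sub_inclusion_mul_retraction * ((p - q) * (N * harmonicProj p h)) +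
    N * H.retraction_mul_diff_mul_inclusion + (p - q) * N * H.h_mul_diff_mul_inclusion +
    N * h * H.diff_diff * (N * harmonicProj p h)

theorem retraction_mul_diff (H : IsPerturbation p q h N) :
    perturbedRetraction p q h N * (p - q) =
      -(harmonicProj p h * q * N * perturbedRetraction p q h N) := by
  set r := perturbedRetraction p q h N with hr
  have hNr : r * (p - q) * (N * r) = -(harmonicProj p h * q * N * r) := by
    rw [hr]
    nth_rw 2 3 [perturbedRetraction]
    linear_combination (norm := noncomm_ring)
      H.retraction_mul_diff_mul_inclusion * (1 + q * N * h)
  linear_combination (norm := noncomm_ring) r * (p - q) * H.one_sub_inclusion_mul_retraction +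
    hNr + r * H.diff_diff * N * h + r * (p - q) * H.inv_eq_one_add * h * (p - q) +
    H.retraction_mul_diff_mul_h * (1 + q * N * h) * (p - q)

end IsPerturbation

end Perturbation

section SupportedBelow

variable {R ι M : Type*} [Semiring R] [Preorder ι] {H H' : ι → Type*} [∀ b, AddCommMonoid (H b)]
  [∀ b, Module R (H b)] [∀ b, AddCommMonoid (H' b)] [∀ b, Module R (H' b)] [AddCommMonoid M]
  [Module R M]

variable (R H) in
/-- The families in `∏ b, H b` that vanish unless `b ≤ c`. For `ι = ℕ^n` this is the part of the
graded module `⨁ b, H b ⊗ k[x](-b)` in degree `c`, a family `h` standing for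
`∑ b, h b ⊗ x^(c-b)`. -/
abbrev supportedBelow (c : ι) : Submodule R (∀ b, H b) :=
  Submodule.pi {b | ¬ b ≤ c} fun _ => ⊥

theorem supportedBelow.apply_eq_zero {c : ι} (x : supportedBelow R H c) {b : ι} (hb : ¬ b ≤ c) :
    x.1 b = 0 :=
  x.2 b hb

theorem supportedBelow.ext {c : ι} {x y : supportedBelow R H c} (h : ∀ b, x.1 b = y.1 b) : x = y :=
  Subtype.ext (funext h)

/-- The diagonal map with components `f b : H b → H' b`. -/
def mapBelow (f : ∀ b, H b →ₗ[R] H' b) (c : ι) :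
    supportedBelow R H c →ₗ[R] supportedBelow R H' c :=
  (LinearMap.pi fun b => f b ∘ₗ LinearMap.proj b).restrict fun x hx b hb => by
    change f b (x b) = 0
    rw [(hx b hb : x b = 0), map_zero]

theorem mapBelow_apply (f : ∀ b, H b →ₗ[R] H' b) {c : ι} (x : supportedBelow R H c) (b : ι) :
    (mapBelow f c x).1 b = f b (x.1 b) :=
  rfl

theorem mapBelow_injective {f : ∀ b, H b →ₗ[R] H' b} (hf : ∀ b, Function.Injective (f b)) (c : ι) :
    Function.Injective (mapBelow f c) := fun _ _ h =>
  supportedBelow.ext fun b => hf b (congrFun (congrArg Subtype.val h) b)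

theorem isSplitting_mapBelow {R ι : Type*} [Ring R] [Preorder ι] {H : ι → Type*}
    [∀ b, AddCommGroup (H b)] [∀ b, Module R (H b)] {p h : ∀ b, Module.End R (H b)}
    (hph : ∀ b, IsSplitting (p b) (h b)) (c : ι) : IsSplitting (mapBelow p c) (mapBelow h c) where
  pp := LinearMap.ext fun x => supportedBelow.ext fun b => LinearMap.congr_fun (hph b).pp (x.1 b)
  hh := LinearMap.ext fun x => supportedBelow.ext fun b => LinearMap.congr_fun (hph b).hh (x.1 b)
  php := LinearMap.ext fun x => supportedBelow.ext fun b => LinearMap.congr_fun (hph b).php (x.1 b)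
  hph := LinearMap.ext fun x => supportedBelow.ext fun b => LinearMap.congr_fun (hph b).hph (x.1 b)

section Sum

variable [LocallyFiniteOrderBot ι]

/-- The map to `M` with components `f b : H b → M`. -/
def sumBelow (f : ∀ b, H b →ₗ[R] M) (c : ι) : supportedBelow R H c →ₗ[R] M :=
  ∑ b ∈ Finset.Iic c, f b ∘ₗ LinearMap.proj b ∘ₗ (supportedBelow R H c).subtype

theorem sumBelow_apply (f : ∀ b, H b →ₗ[R] M) {c : ι} (x : supportedBelow R H c) :
    sumBelow f c x = ∑ b ∈ Finset.Iic c, f b (x.1 b) := by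
  rw [sumBelow, LinearMap.sum_apply]
  rfl

/-- The map with components `f a b : H b → H' a`. -/
def matrixBelow (f : ∀ a b, H b →ₗ[R] H' a) (hf : ∀ a b, ¬ a ≤ b → f a b = 0) (c : ι) :
    supportedBelow R H c →ₗ[R] supportedBelow R H' c :=
  (LinearMap.pi fun a => sumBelow (f a) c).codRestrict _ fun x a ha => by
    change sumBelow (f a) c x = 0
    rw [sumBelow_apply]
    refine Finset.sum_eq_zero fun b hb => ?_
    rw [hf a b fun hab => ha (hab.trans (Finset.mem_Iic.1 hb)), LinearMap.zero_apply]

theorem matrixBelow_apply (f : ∀ a b, H b →ₗ[R] H' a) (hf : ∀ a b, ¬ a ≤ b → f a b = 0) {c : ι}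
    (x : supportedBelow R H c) (a : ι) :
    (matrixBelow f hf c x).1 a = sumBelow (f a) c x :=
  rfl

end Sum

end SupportedBelow

section Total

variable {k : Type*} [Field k] {n : ℕ} {I : Ideal (MvPolynomial (Fin n) k)} {c : Fin n →₀ ℕ}

theorem inclusion_injective (b : Fin n →₀ ℕ) : Function.Injective (inclusion I b) :=
  Subtype.val_injective

theorem inclusion_apply_eq_zero {b : Fin n →₀ ℕ} (x : chains I b) {τ : Finset (Fin n)}
    (hτ : τ ∉ koszulFaces I b) : inclusion I b x τ = 0 :=
  (Finsupp.mem_supported' k _).1 x.2 τ hτ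

theorem koszulBoundary_koszulBoundary (b : Fin n →₀ ℕ) (x : chains I b) :
    koszulBoundary I b (koszulBoundary I b x) = 0 :=
  inclusion_injective b (boundary_boundary _)

theorem koszulBoundary_eq_zero {b : Fin n →₀ ℕ} {x : chains I b} (hx : x ∈ chainsOfCard I b 0) :
    koszulBoundary I b x = 0 :=
  inclusion_injective b <| (boundary_apply _).trans <|
    Finset.sum_eq_zero fun i _ => removeVertex_eq_zero_of_card_eq_zero i hx

theorem stepDown_eq_zero {b : Fin n →₀ ℕ} (i : Fin n) {x : chains I (b + Finsupp.single i 1)}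
    (hx : x ∈ chainsOfCard I _ 0) : stepDown I b i x = 0 :=
  inclusion_injective b (removeVertex_eq_zero_of_card_eq_zero i hx)

theorem koszulBoundary_stepDown (b : Fin n →₀ ℕ) (i : Fin n)
    (x : chains I (b + Finsupp.single i 1)) :
    koszulBoundary I b (stepDown I b i x) + stepDown I b i (koszulBoundary I _ x) = 0 :=
  inclusion_injective b (boundary_removeVertex i _)

variable (I c) in
/-- The families of chains of all the `K^b I` with `b ≤ c`. -/
abbrev totalChains : Submodule k (∀ b, chains I b) :=
  supportedBelow k (chains I) c

variable (I c) in
/-- The differentials `∂^b` of all the `K^b I` together. -/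
def totalBoundary : Module.End k (totalChains I c) :=
  mapBelow (koszulBoundary I) c

variable (I c) in
/-- The sum of all the maps `d₁^i`. -/
def totalStep : Module.End k (totalChains I c) :=
  (LinearMap.pi fun b => ∑ i, stepDown I b i ∘ₗ LinearMap.proj (b + Finsupp.single i 1) :
      Module.End k (∀ b, chains I b)).restrict fun x hx b hb => by
    change (∑ i, stepDown I b i ∘ₗ LinearMap.proj (b + Finsupp.single i 1) : _ →ₗ[k] _) x = 0
    rw [LinearMap.sum_apply]
    refine Finset.sum_eq_zero fun i _ => ?_
    have hx' : x (b + Finsupp.single i 1) = 0 := hx _ fun h => hb (le_self_add.trans h)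
    rw [LinearMap.comp_apply, LinearMap.proj_apply, hx', map_zero]

theorem totalStep_apply (x : totalChains I c) (b : Fin n →₀ ℕ) :
    (totalStep I c x).1 b = ∑ i, stepDown I b i (x.1 (b + Finsupp.single i 1)) := by
  change (∑ i, stepDown I b i ∘ₗ LinearMap.proj (b + Finsupp.single i 1) : _ →ₗ[k] _) x.1 = _
  rw [LinearMap.sum_apply]
  rfl

theorem totalBoundary_mul_totalBoundary : totalBoundary I c * totalBoundary I c = 0 :=
  LinearMap.ext fun x => supportedBelow.ext fun b => koszulBoundary_koszulBoundary b (x.1 b)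

theorem totalStep_mul_totalStep : totalStep I c * totalStep I c = 0 := by
  refine LinearMap.ext fun x => supportedBelow.ext fun b => inclusion_injective b ?_
  have h : inclusion I b ((totalStep I c (totalStep I c x)).1 b) = ∑ i, ∑ j, removeVertex i
      (removeVertex j (inclusion I _ (x.1 (b + Finsupp.single i 1 + Finsupp.single j 1)))) := by
    simp only [totalStep_apply, map_sum]
    rfl
  refine h.trans (sum_sum_eq_zero_of_antisymm _ (fun i j => ?_)
    fun i => removeVertex_removeVertex_self i _)
  rw [add_right_comm b]
  exact removeVertex_anticomm i j _

theorem totalBoundary_anticomm_totalStep :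
    totalBoundary I c * totalStep I c + totalStep I c * totalBoundary I c = 0 := by
  refine LinearMap.ext fun x => supportedBelow.ext fun b => ?_
  change koszulBoundary I b ((totalStep I c x).1 b) + (totalStep I c (totalBoundary I c x)).1 b = 0
  rw [totalStep_apply, totalStep_apply, map_sum (koszulBoundary I b), ← Finset.sum_add_distrib]
  exact Finset.sum_eq_zero fun i _ => koszulBoundary_stepDown b i _

variable (I c) in
/-- The elements of `totalChains I c` of homological degree `j`: the families of
`(j - 1)`-chains. -/
def totalChainsOfCard (j : ℕ) : Submodule k (totalChains I c) :=
  (Submodule.pi Set.univ fun b => chainsOfCard I b j).comap (totalChains I c).subtype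

theorem totalBoundary_mem {j : ℕ} {x : totalChains I c} (hx : x ∈ totalChainsOfCard I c (j + 1)) :
    totalBoundary I c x ∈ totalChainsOfCard I c j :=
  fun b _ => koszulBoundary_card I b (hx b trivial)

theorem totalStep_mem {j : ℕ} {x : totalChains I c} (hx : x ∈ totalChainsOfCard I c (j + 1)) :
    totalStep I c x ∈ totalChainsOfCard I c j := fun b _ => by
  change (totalStep I c x).1 b ∈ _
  rw [totalStep_apply]
  exact sum_mem fun i _ => stepDown_card I b i (hx _ trivial)

theorem totalBoundary_eq_zero {x : totalChains I c} (hx : x ∈ totalChainsOfCard I c 0) :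
    totalBoundary I c x = 0 :=
  supportedBelow.ext fun b => koszulBoundary_eq_zero (hx b trivial)

theorem totalStep_eq_zero {x : totalChains I c} (hx : x ∈ totalChainsOfCard I c 0) :
    totalStep I c x = 0 :=
  supportedBelow.ext fun b => (totalStep_apply x b).trans <|
    Finset.sum_eq_zero fun i _ => stepDown_eq_zero i (hx _ trivial)

variable (I c) in
/-- The differential `∂ - ∑ i, d₁^i`. It is the differential of the cubical chain complex of the
part of the staircase of `I` below `c`, with a face `τ` of `K^b I` standing for the cube spanned by
`b - τ` and `b`. -/
def totalDiff : Module.End k (totalChains I c) :=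
  totalBoundary I c - totalStep I c

theorem totalDiff_mem {j : ℕ} {x : totalChains I c} (hx : x ∈ totalChainsOfCard I c (j + 1)) :
    totalDiff I c x ∈ totalChainsOfCard I c j :=
  sub_mem (totalBoundary_mem hx) (totalStep_mem hx)

theorem totalDiff_eq_zero {x : totalChains I c} (hx : x ∈ totalChainsOfCard I c 0) :
    totalDiff I c x = 0 := by
  rw [totalDiff, LinearMap.sub_apply, totalBoundary_eq_zero hx, totalStep_eq_zero hx, sub_zero]

theorem totalDiff_totalDiff (x : totalChains I c) : totalDiff I c (totalDiff I c x) = 0 :=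
  LinearMap.congr_fun (sub_mul_sub_self_eq_zero (A := Module.End k (totalChains I c))
    totalBoundary_mul_totalBoundary totalStep_mul_totalStep totalBoundary_anticomm_totalStep) x

end Total

section Acyclic

variable {k : Type*} [Field k] {n : ℕ} {I : Ideal (MvPolynomial (Fin n) k)} {c : Fin n →₀ ℕ}

theorem indicator_apply (τ : Finset (Fin n)) (i : Fin n) :
    indicator τ i = if i ∈ τ then 1 else 0 := by
  simp [indicator, Finsupp.finsetSum_apply, Finsupp.single_apply]

theorem indicator_empty : indicator (∅ : Finset (Fin n)) = 0 :=
  Finset.sum_empty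

theorem indicator_insert {i : Fin n} {τ : Finset (Fin n)} (hi : i ∉ τ) :
    indicator (insert i τ) = indicator τ + Finsupp.single i 1 := by
  rw [indicator_erase (Finset.mem_insert_self i τ), Finset.erase_insert hi]

/-- The cubes with lower corner `u` of an element of the cubical chain complex `totalChains I c`,
as a chain of the full simplex. -/
def corner (u : Fin n →₀ ℕ) : totalChains I c →ₗ[k] (Finset (Fin n) →₀ k) :=
  (Finsupp.linearEquivFunOnFinite k k (Finset (Fin n))).symm.toLinearMap ∘ₗ
    LinearMap.pi fun τ => Finsupp.lapply τ ∘ₗ inclusion I (u + indicator τ) ∘ₗ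
      LinearMap.proj (u + indicator τ) ∘ₗ (totalChains I c).subtype

theorem corner_apply (u : Fin n →₀ ℕ) (x : totalChains I c) (τ : Finset (Fin n)) :
    corner u x τ = inclusion I (u + indicator τ) (x.1 (u + indicator τ)) τ :=
  rfl

theorem corner_apply_insert (u : Fin n →₀ ℕ) (x : totalChains I c) {i : Fin n}
    {τ : Finset (Fin n)} (hi : i ∉ τ) :
    corner u x (insert i τ) = inclusion I (u + indicator τ + Finsupp.single i 1)
      (x.1 (u + indicator τ + Finsupp.single i 1)) (insert i τ) := by
  rw [corner_apply, indicator_insert hi, add_assoc]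

theorem inclusion_apply_eq_corner (x : totalChains I c) {b : Fin n →₀ ℕ} {τ : Finset (Fin n)}
    (hτ : indicator τ ≤ b) : inclusion I b (x.1 b) τ = corner (b - indicator τ) x τ := by
  rw [corner_apply, tsub_add_cancel_of_le hτ]

theorem corner_support {u : Fin n →₀ ℕ} {x : totalChains I c} {τ : Finset (Fin n)}
    (h : corner u x τ ≠ 0) :
    u + indicator τ ≤ c ∧ MvPolynomial.monomial u (1 : k) ∈ I := by
  rw [corner_apply] at h
  refine ⟨?_, ?_⟩
  · by_contra hu
    exact h (by rw [supportedBelow.apply_eq_zero x hu, map_zero, Finsupp.zero_apply])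
  · by_contra hu
    refine h (inclusion_apply_eq_zero _ fun hτ => hu ?_)
    simpa only [add_tsub_cancel_right] using hτ.2

theorem corner_eq_zero {u : Fin n →₀ ℕ} (hu : ¬ u ≤ c) (x : totalChains I c) : corner u x = 0 := by
  ext τ
  by_contra h
  exact hu (le_self_add.trans (corner_support h).1)

theorem eq_zero_of_corner_eq_zero {x : totalChains I c} (h : ∀ u, corner u x = 0) : x = 0 := by
  refine supportedBelow.ext fun b => inclusion_injective b (Finsupp.ext fun τ => ?_)
  by_cases hτ : indicator τ ≤ b
  · rw [inclusion_apply_eq_corner x hτ, h]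
    rfl
  · exact inclusion_apply_eq_zero _ fun h => hτ h.1

theorem exists_corner_eq (Y : (Fin n →₀ ℕ) → Finset (Fin n) →₀ k)
    (hY : ∀ u τ, Y u τ ≠ 0 → u + indicator τ ≤ c ∧ MvPolynomial.monomial u (1 : k) ∈ I) :
    ∃ x : totalChains I c, ∀ u, corner u x = Y u := by
  let X (b : Fin n →₀ ℕ) : Finset (Fin n) →₀ k := Finsupp.equivFunOnFinite.symm fun τ =>
    if indicator τ ≤ b then Y (b - indicator τ) τ else 0
  have hXτ (b) (τ) : X b τ = if indicator τ ≤ b then Y (b - indicator τ) τ else 0 := rfl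
  have hX (b) : X b ∈ Finsupp.supported k k (koszulFaces I b) := by
    rw [Finsupp.mem_supported']
    intro τ hτ
    rw [hXτ]
    split_ifs with hb
    · by_contra h
      exact hτ ⟨hb, (hY _ _ h).2⟩
    · rfl
  refine ⟨⟨fun b => ⟨X b, hX b⟩, fun b hb => inclusion_injective b (Finsupp.ext fun τ => ?_)⟩,
    fun u => Finsupp.ext fun τ => ?_⟩
  · change X b τ = 0
    rw [hXτ]
    split_ifs with h
    · by_contra h'
      exact hb ((tsub_add_cancel_of_le h).symm.trans_le (hY _ _ h').1)
    · rfl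
  · change X (u + indicator τ) τ = Y u τ
    rw [hXτ, if_pos le_add_self, add_tsub_cancel_right]

theorem corner_mem {j : ℕ} {x : totalChains I c} (hx : x ∈ totalChainsOfCard I c j)
    (u : Fin n →₀ ℕ) : corner u x ∈ Finsupp.supported k k {τ : Finset (Fin n) | τ.card = j} :=
  (Finsupp.mem_supported' k _).2 fun τ hτ => (Finsupp.mem_supported' k _).1 (hx _ trivial) τ hτ

theorem mem_of_corner_mem {j : ℕ} {x : totalChains I c}
    (h : ∀ u, corner u x ∈ Finsupp.supported k k {τ : Finset (Fin n) | τ.card = j}) :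
    x ∈ totalChainsOfCard I c j := by
  refine fun b _ => (Finsupp.mem_supported' k _).2 fun τ hτ => ?_
  change inclusion I b (x.1 b) τ = 0
  by_cases hb : indicator τ ≤ b
  · rw [inclusion_apply_eq_corner x hb]
    exact (Finsupp.mem_supported' k _).1 (h _) τ hτ
  · exact inclusion_apply_eq_zero _ fun h => hb h.1

theorem corner_totalStep (u : Fin n →₀ ℕ) (x : totalChains I c) :
    corner u (totalStep I c x) = boundary (corner u x) := by
  ext τ
  rw [corner_apply, totalStep_apply, map_sum, boundary_apply, Finsupp.finsetSum_apply,
    Finsupp.finsetSum_apply]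
  refine Finset.sum_congr rfl fun i _ => ?_
  change removeVertex i (inclusion I _ (x.1 _)) τ = _
  rw [removeVertex_apply, removeVertex_apply]
  split_ifs with hi
  · rfl
  · rw [corner_apply_insert u x hi]

theorem corner_totalBoundary (u : Fin n →₀ ℕ) (x : totalChains I c) :
    corner u (totalBoundary I c x) =
      ∑ i, if u i = 0 then 0 else removeVertex i (corner (u - Finsupp.single i 1) x) := by
  ext τ
  rw [corner_apply]
  change boundary (inclusion I _ (x.1 _)) τ = _
  rw [boundary_apply, Finsupp.finsetSum_apply, Finsupp.finsetSum_apply]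
  refine Finset.sum_congr rfl fun i _ => ?_
  split_ifs with hu <;> rw [removeVertex_apply] <;> split_ifs with hi
  · rfl
  · have hτ : insert i τ ∉ koszulFaces I (u + indicator τ) := fun h => by
      simpa [indicator_apply, hi, hu] using h.1 i
    rw [inclusion_apply_eq_zero _ hτ, mul_zero]
    rfl
  · rw [removeVertex_apply, if_pos hi]
  · have hsub : u - Finsupp.single i 1 + indicator τ + Finsupp.single i 1 = u + indicator τ := by
      rw [add_right_comm, Finsupp.sub_add_single_one_cancel hu]
    rw [removeVertex_apply, if_neg hi, corner_apply_insert _ x hi, hsub]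

theorem corner_totalDiff (u : Fin n →₀ ℕ) (x : totalChains I c) :
    corner u (totalDiff I c x) =
      (∑ i, if u i = 0 then 0 else removeVertex i (corner (u - Finsupp.single i 1) x)) -
        boundary (corner u x) := by
  rw [totalDiff, LinearMap.sub_apply, map_sub, corner_totalBoundary, corner_totalStep]

variable (I c) in
/-- The augmentation of the cubical chain complex `totalChains I c`. -/
def totalAugmentation : totalChains I c →ₗ[k] k :=
  ∑ u ∈ Finset.Iic c, Finsupp.lapply ∅ ∘ₗ corner u

theorem totalAugmentation_apply (x : totalChains I c) :
    totalAugmentation I c x = ∑ u ∈ Finset.Iic c, corner u x ∅ := by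
  rw [totalAugmentation, LinearMap.sum_apply]
  rfl

theorem sum_Iic_tsub_single {M : Type*} [AddCommMonoid M] (i : Fin n) (g : (Fin n →₀ ℕ) → M)
    (hg : ∀ u, g u ≠ 0 → u + Finsupp.single i 1 ≤ c) :
    (∑ u ∈ Finset.Iic c, if u i = 0 then 0 else g (u - Finsupp.single i 1)) =
      ∑ u ∈ Finset.Iic c, g u := by
  symm
  refine Finset.sum_bij_ne_zero (fun u _ _ => u + Finsupp.single i 1)
    (fun u _ hu => Finset.mem_Iic.2 (hg u hu)) (fun u _ _ v _ _ h => add_right_cancel h)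
    (fun u hu hu0 => ?_) (fun u _ _ => by simp)
  obtain ⟨hi, hgu⟩ : u i ≠ 0 ∧ g (u - Finsupp.single i 1) ≠ 0 := by simpa using hu0
  exact ⟨u - Finsupp.single i 1, Finset.mem_Iic.2 (tsub_le_self.trans (Finset.mem_Iic.1 hu)), hgu,
    Finsupp.sub_add_single_one_cancel hi⟩

theorem totalAugmentation_totalDiff (x : totalChains I c) :
    totalAugmentation I c (totalDiff I c x) = 0 := by
  have happ (u : Fin n →₀ ℕ) : corner u (totalDiff I c x) ∅ = ∑ i,
      ((if u i = 0 then 0 else removeVertex i (corner (u - Finsupp.single i 1) x) ∅) -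
        removeVertex i (corner u x) ∅) := by
    rw [corner_totalDiff, boundary_apply, Finsupp.sub_apply, Finsupp.finsetSum_apply,
      Finsupp.finsetSum_apply, ← Finset.sum_sub_distrib]
    refine Finset.sum_congr rfl fun i _ => ?_
    split_ifs <;> rfl
  simp only [totalAugmentation_apply, happ]
  rw [Finset.sum_comm]
  refine Finset.sum_eq_zero fun i _ => ?_
  rw [Finset.sum_sub_distrib, sub_eq_zero]
  refine sum_Iic_tsub_single i (fun u => removeVertex i (corner u x) ∅) fun u hu => ?_
  rw [removeVertex_apply, if_neg (Finset.notMem_empty i)] at hu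
  have hle := (corner_support (right_ne_zero_of_mul hu)).1
  rwa [indicator_insert (Finset.notMem_empty i), indicator_empty, zero_add] at hle

theorem eq_zero_of_corner_ne_eq_zero {j : ℕ} {x : totalChains I c}
    (hx : x ∈ totalChainsOfCard I c j) (h0 : j = 0 → totalAugmentation I c x = 0)
    (h : ∀ u ≠ c, corner u x = 0) : x = 0 := by
  refine eq_zero_of_corner_eq_zero fun u => ?_
  rcases ne_or_eq u c with hu | rfl
  · exact h u hu
  ext τ
  by_contra hτ
  have hempty : τ = ∅ := by
    have hle : indicator τ ≤ 0 := by simpa using (corner_support hτ).1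
    refine Finset.eq_empty_of_forall_notMem fun i hi => ?_
    simpa [indicator_apply, hi] using hle i
  subst hempty
  refine hτ ?_
  rw [Finsupp.zero_apply]
  rcases eq_or_ne j 0 with hj | hj
  · rw [← h0 hj, totalAugmentation_apply, Finset.sum_eq_single u]
    · exact fun v _ hv => by rw [h v hv, Finsupp.zero_apply]
    · exact fun hu => absurd (Finset.mem_Iic.2 le_rfl) hu
  · exact (Finsupp.mem_supported' k _).1 (corner_mem hx u) ∅ hj.symm

theorem exists_corner_eq_addVertex {j : ℕ} {x : totalChains I c}
    (hx : x ∈ totalChainsOfCard I c j) :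
    ∃ w ∈ totalChainsOfCard I c (j + 1), ∀ u ≠ c, ∃ i, corner u w = addVertex i (corner u x) := by
  have hY (u : Fin n →₀ ℕ) : ∃ y : Finset (Fin n) →₀ k,
      (∀ τ, y τ ≠ 0 → u + indicator τ ≤ c ∧ MvPolynomial.monomial u (1 : k) ∈ I) ∧
      y ∈ Finsupp.supported k k {τ : Finset (Fin n) | τ.card = j + 1} ∧
      (u ≠ c → ∃ i, y = addVertex i (corner u x)) := by
    by_cases huc : c ≤ u
    · refine ⟨0, fun τ h => absurd rfl h, zero_mem _, fun hne => ?_⟩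
      obtain ⟨i, -⟩ := DFunLike.ne_iff.1 hne
      exact ⟨i, by rw [corner_eq_zero (fun h => hne (h.antisymm huc)), map_zero]⟩
    obtain ⟨i, hi⟩ : ∃ i, u i < c i := by simpa [Finsupp.le_def] using huc
    refine ⟨addVertex i (corner u x), fun τ hτ => ?_, addVertex_card (corner_mem hx u),
      fun _ => ⟨i, rfl⟩⟩
    rw [addVertex_apply] at hτ
    obtain ⟨hiτ, -, hne⟩ : i ∈ τ ∧ vertexSign k i τ ≠ 0 ∧ corner u x (τ.erase i) ≠ 0 := by
      simpa using hτ
    refine ⟨fun l => ?_, (corner_support hne).2⟩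
    have hl := (corner_support hne).1 l
    rw [indicator_erase hiτ]
    rcases eq_or_ne l i with rfl | hli
    · simpa [indicator_apply] using hi
    · simpa [hli] using hl
  choose Y hY₁ hY₂ hY₃ using hY
  obtain ⟨w, hw⟩ := exists_corner_eq Y hY₁
  refine ⟨w, mem_of_corner_mem fun u => hw u ▸ hY₂ u, fun u hu => ?_⟩
  rw [hw]
  exact hY₃ u hu

theorem corner_totalDiff_of_lower {u : Fin n →₀ ℕ} {x : totalChains I c}
    (h : ∀ i, u i ≠ 0 → corner (u - Finsupp.single i 1) x = 0) :
    corner u (totalDiff I c x) = -boundary (corner u x) := by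
  rw [corner_totalDiff, Finset.sum_eq_zero, zero_sub]
  intro i _
  split_ifs with hi
  · rfl
  · rw [h i hi, map_zero]

theorem corner_add_totalDiff_eq_zero {u : Fin n →₀ ℕ} {x w : totalChains I c} {i : Fin n}
    (hd : totalDiff I c x = 0) (hw : corner u w = addVertex i (corner u x))
    (hxu : ∀ i, u i ≠ 0 → corner (u - Finsupp.single i 1) x = 0)
    (hwu : ∀ i, u i ≠ 0 → corner (u - Finsupp.single i 1) w = 0) :
    corner u (x + totalDiff I c w) = 0 := by
  have hcycle : boundary (corner u x) = 0 := by
    rw [← neg_eq_zero, ← corner_totalDiff_of_lower hxu, hd, map_zero]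
  have hhom := boundary_addVertex i (corner u x)
  rw [hcycle, map_zero, add_zero] at hhom
  rw [map_add, corner_totalDiff_of_lower hwu, hw, hhom, add_neg_cancel]

theorem exists_corner_add_totalDiff_eq_zero {j m : ℕ} {x : totalChains I c}
    (hx : x ∈ totalChainsOfCard I c j) (hd : totalDiff I c x = 0)
    (h : ∀ u ≠ c, u.degree + (m + 1) ≤ c.degree → corner u x = 0) :
    ∃ w ∈ totalChainsOfCard I c (j + 1),
      ∀ u ≠ c, u.degree + m ≤ c.degree → corner u (x + totalDiff I c w) = 0 := by
  obtain ⟨w, hw, hwx⟩ := exists_corner_eq_addVertex hx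
  refine ⟨w, hw, fun u huc hu => ?_⟩
  have hlower (i : Fin n) (hi : u i ≠ 0) : corner (u - Finsupp.single i 1) x = 0 ∧
      corner (u - Finsupp.single i 1) w = 0 := by
    have hdeg : (u - Finsupp.single i 1).degree + 1 = u.degree := by
      conv_rhs => rw [← Finsupp.sub_add_single_one_cancel hi, map_add, Finsupp.degree_single]
    have hne : u - Finsupp.single i 1 ≠ c := fun heq => by
      rw [heq] at hdeg
      omega
    have hx0 := h _ hne (by omega)
    obtain ⟨l, hl⟩ := hwx _ hne
    exact ⟨hx0, by rw [hl, hx0, map_zero]⟩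
  obtain ⟨i, hi⟩ := hwx u huc
  exact corner_add_totalDiff_eq_zero hd hi (fun i hi => (hlower i hi).1) fun i hi => (hlower i hi).2

/-- The cubical chain complex `totalChains I c` is contracted one lower corner after the other, by
increasing degree of the corner. -/
theorem exists_totalDiff_eq {j : ℕ} {x : totalChains I c} (hx : x ∈ totalChainsOfCard I c j)
    (hd : totalDiff I c x = 0) (h0 : j = 0 → totalAugmentation I c x = 0) :
    ∃ y ∈ totalChainsOfCard I c (j + 1), totalDiff I c y = x := by
  suffices h : ∀ m, ∀ x ∈ totalChainsOfCard I c j, totalDiff I c x = 0 →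
      (j = 0 → totalAugmentation I c x = 0) →
      (∀ u ≠ c, u.degree + m ≤ c.degree → corner u x = 0) →
      ∃ y ∈ totalChainsOfCard I c (j + 1), totalDiff I c y = x from
    h (c.degree + 1) x hx hd h0 fun u _ hu => by omega
  intro m
  induction m with
  | zero =>
    intro x hx _ h0 hcorner
    suffices hx0 : x = 0 from ⟨0, zero_mem _, by rw [hx0, map_zero]⟩
    refine eq_zero_of_corner_ne_eq_zero hx h0 fun u hu => ?_
    by_cases huc : u ≤ c
    · exact hcorner u hu (Finsupp.degree_mono huc)
    · exact corner_eq_zero huc x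
  | succ m ih =>
    intro x hx hd h0 hcorner
    obtain ⟨w, hw, hwx⟩ := exists_corner_add_totalDiff_eq_zero hx hd hcorner
    obtain ⟨y, hy, hyx⟩ := ih (x + totalDiff I c w) (add_mem hx (totalDiff_mem hw))
      (by rw [map_add, hd, totalDiff_totalDiff, add_zero])
      (fun hj => by rw [map_add, h0 hj, totalAugmentation_totalDiff, add_zero]) hwx
    exact ⟨y - w, sub_mem hy hw, by rw [map_sub, hyx, add_sub_cancel_right]⟩

end Acyclic

section Splitting

variable {k : Type*} [Field k] {n : ℕ} {I : Ideal (MvPolynomial (Fin n) k)} {c : Fin n →₀ ℕ}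

theorem Splitting.isSplitting {b : Fin n →₀ ℕ} (s : Splitting I b) :
    IsSplitting (A := Module.End k (chains I b)) (koszulBoundary I b) s.up where
  pp := LinearMap.ext (koszulBoundary_koszulBoundary b)
  hh := s.up_up
  php := s.del_up_del
  hph := s.up_del_up

/-- The splittings `∂^{b+}` of all the `K^b I` together. -/
def totalUp (s : ∀ b, Splitting I b) (c : Fin n →₀ ℕ) : Module.End k (totalChains I c) :=
  mapBelow (fun b => (s b).up) c

theorem totalUp_mem (s : ∀ b, Splitting I b) {j : ℕ} {x : totalChains I c}
    (hx : x ∈ totalChainsOfCard I c j) : totalUp s c x ∈ totalChainsOfCard I c (j + 1) :=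
  fun b _ => (s b).up_mem _ _ (hx b trivial)

theorem totalUp_mul_totalStep_pow_apply_eq_zero (s : ∀ b, Splitting I b) (m : ℕ)
    (x : totalChains I c) (b : Fin n →₀ ℕ) (h : c.degree < b.degree + m) :
    (((totalUp s c * totalStep I c) ^ m) x).1 b = 0 := by
  induction m generalizing b with
  | zero => exact supportedBelow.apply_eq_zero x fun hb => h.not_ge (Finsupp.degree_mono hb)
  | succ m ih =>
    rw [pow_succ']
    refine (congrArg (s b).up ?_).trans (map_zero _)
    refine (totalStep_apply _ b).trans (Finset.sum_eq_zero fun i _ => ?_)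
    rw [ih, map_zero]
    rw [map_add, Finsupp.degree_single]
    omega

theorem totalUp_mul_totalStep_pow_eq_zero (s : ∀ b, Splitting I b) (c : Fin n →₀ ℕ) :
    (totalUp s c * totalStep I c) ^ (c.degree + 1) = 0 :=
  LinearMap.ext fun x => supportedBelow.ext fun b =>
    totalUp_mul_totalStep_pow_apply_eq_zero s _ x b (by omega)

/-- The inverse of `1 - ∂⁺d₁`, where `d₁` is the sum of all the `d₁^i`. -/
def totalInverse (s : ∀ b, Splitting I b) (c : Fin n →₀ ℕ) : Module.End k (totalChains I c) :=
  ∑ m ∈ Finset.range (c.degree + 1), (totalUp s c * totalStep I c) ^ m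

theorem isPerturbation (s : ∀ b, Splitting I b) (c : Fin n →₀ ℕ) :
    IsPerturbation (totalBoundary I c) (totalStep I c) (totalUp s c) (totalInverse s c) where
  toIsSplitting := isSplitting_mapBelow (fun b => (s b).isSplitting) c
  qq := totalStep_mul_totalStep
  pq := totalBoundary_anticomm_totalStep
  inv_mul := (geom_sum_mul_neg (totalUp s c * totalStep I c) _).trans <|
    (congrArg (1 - ·) (totalUp_mul_totalStep_pow_eq_zero s c)).trans <|
    sub_zero (1 : Module.End k (totalChains I c))
  mul_inv := (mul_neg_geom_sum (totalUp s c * totalStep I c) _).trans <|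
    (congrArg (1 - ·) (totalUp_mul_totalStep_pow_eq_zero s c)).trans <|
    sub_zero (1 : Module.End k (totalChains I c))

theorem totalInverse_mem (s : ∀ b, Splitting I b) {j : ℕ} {x : totalChains I c}
    (hx : x ∈ totalChainsOfCard I c j) : totalInverse s c x ∈ totalChainsOfCard I c j := by
  have hpow (m : ℕ) : ((totalUp s c * totalStep I c) ^ m) x ∈ totalChainsOfCard I c j := by
    induction m with
    | zero => exact hx
    | succ m ih =>
      rw [pow_succ', Module.End.mul_apply, Module.End.mul_apply]
      cases j with
      | zero => rw [totalStep_eq_zero ih, map_zero]; exact zero_mem _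
      | succ j => exact totalUp_mem s (totalStep_mem ih)
  rw [totalInverse, LinearMap.sum_apply]
  exact sum_mem fun m _ => hpow m

theorem totalInverse_eq_self (s : ∀ b, Splitting I b) {x : totalChains I c}
    (hx : x ∈ totalChainsOfCard I c 0) : totalInverse s c x = x := by
  rw [(isPerturbation s c).inv_eq_one_add', LinearMap.add_apply, Module.End.mul_apply,
    totalStep_eq_zero hx, map_zero, add_zero, Module.End.one_apply]

end Splitting

section Paths

theorem LatticePath.lt {n : ℕ} {a b : Fin n →₀ ℕ} (p : LatticePath a b) : a < b := by
  induction p with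
  | step i => exact lt_add_of_pos_right _ (pos_of_ne_zero (Finsupp.single_ne_zero.2 one_ne_zero))
  | cons i _ ih => exact ih.trans_le le_self_add

/-- A path is either a single step or a first step followed by a path. -/
def LatticePath.splitEquiv {n : ℕ} (a : Fin n →₀ ℕ) :
    (Σ b, LatticePath a b) ≃ Fin n ⊕ Fin n × Σ b, LatticePath a b where
  toFun
    | ⟨_, .step i⟩ => .inl i
    | ⟨_, .cons i p⟩ => .inr (i, ⟨_, p⟩)
  invFun := Sum.elim (fun i => ⟨_, .step i⟩) fun p => ⟨_, .cons p.1 p.2.2⟩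
  left_inv := by rintro ⟨_, _ | _⟩ <;> rfl
  right_inv := by rintro (_ | _) <;> rfl

theorem sum_latticePath_eq {n : ℕ} {M : Type*} [AddCommMonoid M] {a c : Fin n →₀ ℕ}
    (f : ∀ b, LatticePath a b → M) (hf : ∀ b p, ¬ b ≤ c → f b p = 0) :
    ∑ b ∈ Finset.Iic c, ∑ p, f b p = ∑ i, f _ (.step i) +
      ∑ b ∈ Finset.Iic c, ∑ p : LatticePath a b, ∑ i, f _ (.cons i p) := by
  let paths : Finset (Σ b, LatticePath a b) := (Finset.Iic c).sigma fun _ => Finset.univ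
  let g (e : Fin n ⊕ Fin n × Σ b, LatticePath a b) : M :=
    f _ ((LatticePath.splitEquiv a).symm e).2
  have hl : ∑ b ∈ Finset.Iic c, ∑ p, f b p = ∑ e ∈ paths, f e.1 e.2 :=
    (Finset.sum_sigma _ _ fun e : Σ b, LatticePath a b => f e.1 e.2).symm
  have hr : ∑ i, f _ (.step i) + ∑ b ∈ Finset.Iic c, ∑ p : LatticePath a b, ∑ i, f _ (.cons i p) =
      ∑ e ∈ Finset.univ.disjSum (Finset.univ ×ˢ paths), g e := by
    rw [Finset.sum_disjSum, Finset.sum_product_right, Finset.sum_sigma]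
    rfl
  rw [hl, hr]
  refine Finset.sum_of_injOn _ (LatticePath.splitEquiv a).injective.injOn ?_ ?_ ?_
  · rintro ⟨b, p⟩ hp
    have hb : b ≤ c := Finset.mem_Iic.1 (Finset.mem_sigma.1 hp).1
    cases p with
    | step i => exact Finset.mem_coe.2 (Finset.inl_mem_disjSum.2 (Finset.mem_univ i))
    | cons i p =>
      exact Finset.mem_coe.2 <| Finset.inr_mem_disjSum.2 <| Finset.mem_product.2
        ⟨Finset.mem_univ i, Finset.mem_sigma.2
          ⟨Finset.mem_Iic.2 (le_self_add.trans hb), Finset.mem_univ p⟩⟩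
  · refine fun e _ he => hf _ _ fun hle => he ⟨(LatticePath.splitEquiv a).symm e, ?_, ?_⟩
    · exact Finset.mem_sigma.2 ⟨Finset.mem_Iic.2 hle, Finset.mem_univ _⟩
    · exact (LatticePath.splitEquiv a).apply_symm_apply e
  · exact fun e _ => congrArg (fun e : Σ b, LatticePath a b => f e.1 e.2)
      ((LatticePath.splitEquiv a).symm_apply_apply e).symm

variable {k : Type*} [Field k] {n : ℕ} {I : Ideal (MvPolynomial (Fin n) k)} {c : Fin n →₀ ℕ}

/-- The sum, over all paths that end in `a`, of the composites of the `∂⁺` and `d₁` along them. -/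
def pathTransport (s : ∀ b, Splitting I b) (c a : Fin n →₀ ℕ) : totalChains I c →ₗ[k] chains I a :=
  sumBelow (fun _ => ∑ p : LatticePath a _, p.transport s) c

theorem pathTransport_apply (s : ∀ b, Splitting I b) (a : Fin n →₀ ℕ) (x : totalChains I c) :
    pathTransport s c a x =
      ∑ b ∈ Finset.Iic c, ∑ p : LatticePath a b, p.transport s (x.1 b) := by
  rw [pathTransport, sumBelow_apply]
  simp only [LinearMap.sum_apply]

theorem pathTransport_eq_add (s : ∀ b, Splitting I b) (a : Fin n →₀ ℕ) (x : totalChains I c) :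
    pathTransport s c a x =
      (totalStep I c x).1 a + pathTransport s c a (totalUp s c (totalStep I c x)) := by
  have htransport (b) (p : LatticePath a b) :
      p.transport s ((totalUp s c (totalStep I c x)).1 b) =
        ∑ i, (LatticePath.cons i p).transport s (x.1 (b + Finsupp.single i 1)) := by
    rw [totalUp, mapBelow_apply, totalStep_apply, map_sum, map_sum]
    rfl
  rw [pathTransport_apply, pathTransport_apply, totalStep_apply]
  simp only [htransport]
  exact sum_latticePath_eq (fun b p => p.transport s (x.1 b)) fun b p hb => by
    rw [supportedBelow.apply_eq_zero x hb, map_zero]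

theorem pathTransport_eq (s : ∀ b, Splitting I b) (a : Fin n →₀ ℕ) (x : totalChains I c) :
    pathTransport s c a x = (totalStep I c (totalInverse s c x)).1 a := by
  have hx : totalInverse s c x - totalUp s c (totalStep I c (totalInverse s c x)) = x :=
    LinearMap.congr_fun (isPerturbation s c).mul_inv x
  conv_lhs => rw [← hx]
  rw [map_sub, sub_eq_iff_eq_add]
  exact pathTransport_eq_add s a _

end Paths

section Homology

variable {k : Type*} [Field k] {n : ℕ} {I : Ideal (MvPolynomial (Fin n) k)} {b c : Fin n →₀ ℕ}

/-- The projection `1 - ∂^b∂^{b+} - ∂^{b+}∂^b` to the harmonic chains of `K^b I`. -/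
def Splitting.proj (s : Splitting I b) : Module.End k (chains I b) :=
  harmonicProj (koszulBoundary I b) s.up

theorem Splitting.koszulBoundary_proj (s : Splitting I b) (x : chains I b) :
    koszulBoundary I b (s.proj x) = 0 :=
  LinearMap.congr_fun s.isSplitting.p_mul_harmonicProj x

theorem Splitting.proj_koszulBoundary (s : Splitting I b) (x : chains I b) :
    s.proj (koszulBoundary I b x) = 0 :=
  LinearMap.congr_fun s.isSplitting.harmonicProj_mul_p x

theorem Splitting.proj_up (s : Splitting I b) (x : chains I b) : s.proj (s.up x) = 0 :=
  LinearMap.congr_fun s.isSplitting.harmonicProj_mul_h x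

theorem Splitting.proj_proj (s : Splitting I b) (x : chains I b) : s.proj (s.proj x) = s.proj x :=
  LinearMap.congr_fun s.isSplitting.harmonicProj_mul_self x

theorem Splitting.proj_eq_sub (s : Splitting I b) {x : chains I b} (hx : koszulBoundary I b x = 0) :
    s.proj x = x - koszulBoundary I b (s.up x) := by
  change x - koszulBoundary I b (s.up x) - s.up (koszulBoundary I b x) = _
  rw [hx, map_zero, sub_zero]

theorem Splitting.proj_mem (s : Splitting I b) {j : ℕ} {x : chains I b}
    (hx : x ∈ chainsOfCard I b j) : s.proj x ∈ chainsOfCard I b j := by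
  have hup : x - koszulBoundary I b (s.up x) ∈ chainsOfCard I b j :=
    sub_mem hx (koszulBoundary_card I b (s.up_mem _ _ hx))
  cases j with
  | zero => rwa [s.proj_eq_sub (koszulBoundary_eq_zero hx)]
  | succ j => exact sub_mem hup (s.up_mem _ _ (koszulBoundary_card I b hx))

/-- The harmonic representative of a homology class. -/
def harmonicRep (s : Splitting I b) (j : ℕ) : homology I b j →ₗ[k] chains I b :=
  Submodule.liftQ _ (s.proj ∘ₗ (cycles I b j).subtype) <| by
    rintro z ⟨x, -, hx⟩
    exact (congrArg s.proj hx.symm).trans (s.proj_koszulBoundary x)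

theorem harmonicRep_mk (s : Splitting I b) {j : ℕ} (z : cycles I b j) :
    harmonicRep s j (Submodule.Quotient.mk z) = s.proj z.1 :=
  rfl

theorem harmonicRep_injective (s : Splitting I b) (j : ℕ) :
    Function.Injective (harmonicRep s j) := by
  refine (injective_iff_map_eq_zero _).2 fun h hh => ?_
  obtain ⟨z, rfl⟩ := Submodule.Quotient.mk_surjective _ h
  rw [harmonicRep_mk, s.proj_eq_sub z.2.2, sub_eq_zero] at hh
  exact (Submodule.Quotient.mk_eq_zero _).2 ⟨s.up z.1, s.up_mem _ _ z.2.1, hh.symm⟩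

theorem harmonicRep_mem (s : Splitting I b) {j : ℕ} (h : homology I b j) :
    harmonicRep s j h ∈ chainsOfCard I b j := by
  obtain ⟨z, rfl⟩ := Submodule.Quotient.mk_surjective _ h
  exact s.proj_mem z.2.1

theorem proj_harmonicRep (s : Splitting I b) {j : ℕ} (h : homology I b j) :
    s.proj (harmonicRep s j h) = harmonicRep s j h := by
  obtain ⟨z, rfl⟩ := Submodule.Quotient.mk_surjective _ h
  exact s.proj_proj z.1

theorem exists_harmonicRep_eq_proj (s : Splitting I b) {j : ℕ} {x : chains I b}
    (hx : x ∈ chainsOfCard I b j) : ∃ h, harmonicRep s j h = s.proj x :=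
  ⟨Submodule.Quotient.mk ⟨s.proj x, s.proj_mem hx, s.koszulBoundary_proj x⟩, s.proj_proj x⟩

theorem pathSum_apply (s : ∀ b, Splitting I b) (a : Fin n →₀ ℕ) {x : chains I b}
    (hx : koszulBoundary I b x = 0) :
    pathSum s a b x = ∑ p : LatticePath a b, p.transport s ((s b).proj x) -
      (s a).up (koszulBoundary I a (∑ p : LatticePath a b, p.transport s ((s b).proj x))) := by
  rw [pathSum, LinearMap.sum_apply, map_sum, map_sum, ← Finset.sum_sub_distrib,
    (s b).proj_eq_sub hx]
  rfl

theorem harmonicRep_homologyMap (s : ∀ b, Splitting I b) (a b : Fin n →₀ ℕ) (j : ℕ)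
    (h : homology I b (j + 1)) :
    harmonicRep (s a) j (homologyMap s a b j h) =
      (s a).proj (∑ p : LatticePath a b, p.transport s (harmonicRep (s b) (j + 1) h)) := by
  obtain ⟨z, rfl⟩ := Submodule.Quotient.mk_surjective _ h
  change (s a).proj (pathSum s a b z.1) = _
  rw [pathSum_apply s a z.2.2, map_sub, Splitting.proj_up, sub_zero, harmonicRep_mk]

theorem homologyMap_eq_zero (s : ∀ b, Splitting I b) {a b : Fin n →₀ ℕ} (j : ℕ) (hab : ¬ a < b) :
    homologyMap s a b j = 0 := by
  have : IsEmpty (LatticePath a b) := ⟨fun p => hab p.lt⟩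
  refine LinearMap.ext fun h => harmonicRep_injective (s a) j ?_
  rw [harmonicRep_homologyMap, Finset.univ_eq_empty, Finset.sum_empty, map_zero,
    LinearMap.zero_apply, map_zero]

end Homology

section DegreewiseResolution

variable {k : Type*} [Field k] {n : ℕ} {I : Ideal (MvPolynomial (Fin n) k)} {c : Fin n →₀ ℕ}

/-- The differential of the resolution in degree `c`. -/
def degreeDiff (s : ∀ b, Splitting I b) (j : ℕ) (c : Fin n →₀ ℕ) :
    supportedBelow k (homology I · (j + 1)) c →ₗ[k] supportedBelow k (homology I · j) c :=
  matrixBelow (fun a b => homologyMap s a b j)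
    (fun _ _ hab => homologyMap_eq_zero s j (mt le_of_lt hab)) c

/-- The family of harmonic representatives of a family of homology classes. -/
def totalRep (s : ∀ b, Splitting I b) (j : ℕ) (c : Fin n →₀ ℕ) :
    supportedBelow k (homology I · j) c →ₗ[k] totalChains I c :=
  mapBelow (fun b => harmonicRep (s b) j) c

variable (s : ∀ b, Splitting I b) {j : ℕ}

theorem totalRep_injective : Function.Injective (totalRep s j c) :=
  mapBelow_injective (fun b => harmonicRep_injective (s b) j) c

theorem totalRep_mem (x : supportedBelow k (homology I · j) c) :
    totalRep s j c x ∈ totalChainsOfCard I c j :=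
  fun b _ => harmonicRep_mem (s b) (x.1 b)

theorem harmonicProj_totalRep (x : supportedBelow k (homology I · j) c) :
    harmonicProj (totalBoundary I c) (totalUp s c) (totalRep s j c x) = totalRep s j c x :=
  supportedBelow.ext fun b => proj_harmonicRep (s b) (x.1 b)

theorem exists_totalRep_eq_harmonicProj {x : totalChains I c} (hx : x ∈ totalChainsOfCard I c j) :
    ∃ y, totalRep s j c y = harmonicProj (totalBoundary I c) (totalUp s c) x := by
  have h : ∀ b, ∃ y, harmonicRep (s b) j y = (s b).proj (x.1 b) :=
    fun b => exists_harmonicRep_eq_proj (s b) (hx b trivial)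
  choose y hy using h
  refine ⟨⟨y, fun b hb => harmonicRep_injective (s b) j ?_⟩, supportedBelow.ext hy⟩
  rw [hy, supportedBelow.apply_eq_zero x hb, map_zero, map_zero]

/-- The retraction from the total complex to the harmonic chains. -/
def totalRetraction (s : ∀ b, Splitting I b) (c : Fin n →₀ ℕ) : Module.End k (totalChains I c) :=
  perturbedRetraction (totalBoundary I c) (totalStep I c) (totalUp s c) (totalInverse s c)

theorem exists_totalRep_eq_totalRetraction {x : totalChains I c}
    (hx : x ∈ totalChainsOfCard I c j) : ∃ y, totalRep s j c y = totalRetraction s c x :=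
  exists_totalRep_eq_harmonicProj s
    (add_mem hx (totalStep_mem (totalInverse_mem s (totalUp_mem s hx))))

theorem totalRep_degreeDiff (x : supportedBelow k (homology I · (j + 1)) c) :
    totalRep s j c (degreeDiff s j c x) =
      harmonicProj (totalBoundary I c) (totalUp s c)
        (totalStep I c (totalInverse s c (totalRep s (j + 1) c x))) := by
  refine supportedBelow.ext fun a => ?_
  change harmonicRep (s a) j (sumBelow (fun b => homologyMap s a b j) c x) =
    (s a).proj ((totalStep I c (totalInverse s c (totalRep s (j + 1) c x))).1 a)
  rw [← pathTransport_eq, pathTransport_apply, sumBelow_apply, map_sum, map_sum]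
  exact Finset.sum_congr rfl fun b _ => harmonicRep_homologyMap s a b j (x.1 b)

theorem totalDiff_totalInverse_totalRep (x : supportedBelow k (homology I · (j + 1)) c) :
    totalDiff I c (totalInverse s c (totalRep s (j + 1) c x)) =
      -totalInverse s c (totalRep s j c (degreeDiff s j c x)) := by
  have h := LinearMap.congr_fun (isPerturbation s c).diff_mul_inclusion (totalRep s (j + 1) c x)
  simp only [Module.End.mul_apply, LinearMap.neg_apply] at h
  rwa [harmonicProj_totalRep, ← totalRep_degreeDiff] at h

theorem totalInverse_injective (c : Fin n →₀ ℕ) : Function.Injective (totalInverse s c) :=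
  have H := isPerturbation s c
  ((Module.End.isUnit_iff _).1 (Units.isUnit ⟨_, _, H.inv_mul, H.mul_inv⟩)).injective

theorem degreeDiff_degreeDiff (x : supportedBelow k (homology I · (j + 2)) c) :
    degreeDiff s j c (degreeDiff s (j + 1) c x) = 0 := by
  apply totalRep_injective s
  apply totalInverse_injective s c
  rw [← neg_inj, ← totalDiff_totalInverse_totalRep, ← neg_inj, ← map_neg,
    ← totalDiff_totalInverse_totalRep, totalDiff_totalDiff, map_zero, map_zero, neg_zero, neg_zero]

theorem exists_degreeDiff_eq {x : supportedBelow k (homology I · j) c}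
    (hd : totalDiff I c (totalInverse s c (totalRep s j c x)) = 0)
    (h0 : j = 0 → totalAugmentation I c (totalInverse s c (totalRep s j c x)) = 0) :
    ∃ y, degreeDiff s j c y = x := by
  obtain ⟨w, hw, hwx⟩ := exists_totalDiff_eq (totalInverse_mem s (totalRep_mem s x)) hd h0
  obtain ⟨y, hy⟩ := exists_totalRep_eq_totalRetraction s hw
  have hr : totalRetraction s c (totalDiff I c w) =
      -totalRep s j c (degreeDiff s j c y) := by
    rw [totalRep_degreeDiff, hy]
    exact LinearMap.congr_fun (isPerturbation s c).retraction_mul_diff w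
  have hx : totalRetraction s c (totalDiff I c w) = totalRep s j c x := by
    have h := LinearMap.congr_fun (isPerturbation s c).retraction_mul_inclusion (totalRep s j c x)
    simp only [Module.End.mul_apply] at h
    rwa [harmonicProj_totalRep, ← hwx] at h
  exact ⟨-y, totalRep_injective s <|
    (map_neg (totalRep s j c ∘ₗ degreeDiff s j c) y).trans (hr.symm.trans hx)⟩

theorem exact_degreeDiff (j : ℕ) (c : Fin n →₀ ℕ) :
    Function.Exact (degreeDiff s (j + 1) c) (degreeDiff s j c) := by
  refine fun x => ⟨fun hx => exists_degreeDiff_eq s ?_ (absurd · j.succ_ne_zero), ?_⟩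
  · rw [totalDiff_totalInverse_totalRep, hx, map_zero, map_zero, neg_zero]
  · rintro ⟨y, rfl⟩
    exact degreeDiff_degreeDiff s y

/-- The coefficient of the empty face in the harmonic representative. -/
def homologyAugmentation {b : Fin n →₀ ℕ} (s : Splitting I b) : homology I b 0 →ₗ[k] k :=
  Finsupp.lapply ∅ ∘ₗ inclusion I b ∘ₗ harmonicRep s 0

/-- The augmentation of the resolution in degree `c`. -/
def degreeAugmentation (c : Fin n →₀ ℕ) : supportedBelow k (homology I · 0) c →ₗ[k] k :=
  sumBelow (fun b => homologyAugmentation (s b)) c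

theorem totalAugmentation_totalRep (x : supportedBelow k (homology I · 0) c) :
    totalAugmentation I c (totalRep s 0 c x) = degreeAugmentation s c x := by
  rw [totalAugmentation_apply, degreeAugmentation, sumBelow_apply]
  refine Finset.sum_congr rfl fun b _ => ?_
  rw [corner_apply, indicator_empty, add_zero]
  rfl

theorem degreeAugmentation_degreeDiff (x : supportedBelow k (homology I · 1) c) :
    degreeAugmentation s c (degreeDiff s 0 c x) = 0 := by
  rw [← totalAugmentation_totalRep, ← totalInverse_eq_self s (totalRep_mem s _), ← neg_eq_zero,
    ← map_neg, ← totalDiff_totalInverse_totalRep, totalAugmentation_totalDiff]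

theorem exact_degreeAugmentation (c : Fin n →₀ ℕ) :
    Function.Exact (degreeDiff s 0 c) (degreeAugmentation s c) := by
  refine fun x => ⟨fun hx => exists_degreeDiff_eq s ?_ fun _ => ?_, ?_⟩
  · rw [totalInverse_eq_self s (totalRep_mem s x), totalDiff_eq_zero (totalRep_mem s x)]
  · rw [totalInverse_eq_self s (totalRep_mem s x), totalAugmentation_totalRep, hx]
  · rintro ⟨y, rfl⟩
    exact degreeAugmentation_degreeDiff s y

theorem exists_totalAugmentation_eq_one (hc : MvPolynomial.monomial c (1 : k) ∈ I) :
    ∃ t ∈ totalChainsOfCard I c 0, totalAugmentation I c t = 1 := by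
  classical
  obtain ⟨t, ht⟩ := exists_corner_eq (I := I) (c := c)
    (Pi.single c (Finsupp.single ∅ (1 : k))) fun u τ h => by
      obtain rfl : u = c := by
        by_contra hu
        exact h (by rw [Pi.single_eq_of_ne hu, Finsupp.zero_apply])
      obtain rfl : ∅ = τ := by
        by_contra hτ
        exact h (by rw [Pi.single_eq_same, Finsupp.single_eq_of_ne' hτ])
      exact ⟨by rw [indicator_empty, add_zero], hc⟩
  refine ⟨t, mem_of_corner_mem fun u => ?_, ?_⟩
  · rw [ht]
    rcases eq_or_ne u c with rfl | hu
    · rw [Pi.single_eq_same]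
      exact Finsupp.single_mem_supported k _ rfl
    · rw [Pi.single_eq_of_ne hu]
      exact zero_mem _
  · rw [totalAugmentation_apply, Finset.sum_eq_single_of_mem c (Finset.mem_Iic.2 le_rfl), ht,
      Pi.single_eq_same, Finsupp.single_eq_same]
    intro u _ hu
    rw [ht, Pi.single_eq_of_ne hu, Finsupp.zero_apply]

theorem totalAugmentation_totalInverse_totalRetraction {t : totalChains I c}
    (ht : t ∈ totalChainsOfCard I c 0) :
    totalAugmentation I c (totalInverse s c (totalRetraction s c t)) =
      totalAugmentation I c t := by
  have h : t - totalInverse s c (totalRetraction s c t) =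
      totalDiff I c (totalInverse s c (totalUp s c t)) +
        totalInverse s c (totalUp s c (totalDiff I c t)) :=
    LinearMap.congr_fun (isPerturbation s c).one_sub_inclusion_mul_retraction t
  rw [totalDiff_eq_zero ht, map_zero, map_zero, add_zero, sub_eq_iff_eq_add] at h
  conv_rhs => rw [h, map_add, totalAugmentation_totalDiff, zero_add]

theorem degreeAugmentation_surjective (hc : MvPolynomial.monomial c (1 : k) ∈ I) :
    Function.Surjective (degreeAugmentation s c) := by
  obtain ⟨t, ht, hta⟩ := exists_totalAugmentation_eq_one hc
  obtain ⟨x, hx⟩ := exists_totalRep_eq_totalRetraction s ht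
  have hx1 : degreeAugmentation s c x = 1 := by
    rw [← totalAugmentation_totalRep, ← totalInverse_eq_self s (totalRep_mem s x), hx,
      totalAugmentation_totalInverse_totalRetraction s ht, hta]
  exact fun r => ⟨r • x, by rw [map_smul, hx1, smul_eq_mul, mul_one]⟩

end DegreewiseResolution

section Finiteness

variable {k : Type*} [Field k] {n : ℕ} {I : Ideal (MvPolynomial (Fin n) k)}

theorem finite_directSum {R ι : Type*} [Semiring R] {M : ι → Type*} [∀ i, AddCommMonoid (M i)]
    [∀ i, Module R (M i)] [∀ i, Module.Finite R (M i)] (s : Finset ι)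
    (hs : ∀ i ∉ s, Subsingleton (M i)) : Module.Finite R (⨁ i, M i) := by
  classical
  have htop : (⊤ : Submodule R (⨁ i, M i)) =
      ⨆ i ∈ s, LinearMap.range (DirectSum.lof R ι M i) := by
    refine (eq_top_iff.2 fun y _ => ?_).symm
    induction y using DirectSum.induction_on with
    | zero => exact zero_mem _
    | add x y hx hy => exact add_mem (hx trivial) (hy trivial)
    | of i x =>
      by_cases hi : i ∈ s
      · exact Submodule.mem_iSup_of_mem i (Submodule.mem_iSup_of_mem hi ⟨x, rfl⟩)
      · have := hs i hi
        rw [Subsingleton.elim x 0, map_zero]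
        exact zero_mem _
  rw [Module.finite_def, htop]
  exact Submodule.fg_biSup _ _ fun i _ => Submodule.FG.of_finite

theorem monomial_mem_of_le {u v : Fin n →₀ ℕ} (huv : u ≤ v)
    (hu : MvPolynomial.monomial u (1 : k) ∈ I) : MvPolynomial.monomial v (1 : k) ∈ I :=
  I.mem_of_dvd (MvPolynomial.monomial_dvd_monomial.2 ⟨Or.inr huv, dvd_rfl⟩) hu

/-- The exponent `m` is the least common multiple of finitely many monomials that generate `I`. -/
theorem IsMonomialIdeal.exists_bound (hI : IsMonomialIdeal I) :
    ∃ m : Fin n →₀ ℕ, ∀ u : Fin n →₀ ℕ, MvPolynomial.monomial u (1 : k) ∈ I →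
      MvPolynomial.monomial (u ⊓ m) (1 : k) ∈ I := by
  classical
  obtain ⟨S, rfl⟩ := hI
  obtain ⟨t, htS, ht⟩ := (Submodule.fg_span_iff_fg_span_finset_subset _).1 (IsNoetherian.noetherian
    (Ideal.span ((fun u => MvPolynomial.monomial u (1 : k)) '' S)))
  obtain ⟨T, -, rfl⟩ := Finset.subset_set_image_iff.1 htS
  rw [Finset.coe_image] at ht
  refine ⟨T.sup id, fun u hu => ?_⟩
  have hspan : Ideal.span ((fun u => MvPolynomial.monomial u (1 : k)) '' S) =
      Ideal.span ((fun u => MvPolynomial.monomial u (1 : k)) '' (T : Set (Fin n →₀ ℕ))) := ht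
  rw [hspan] at hu ⊢
  obtain ⟨w, hw, hwu⟩ := MvPolynomial.mem_ideal_span_monomial_image.1 hu u <| by
    rw [MvPolynomial.support_monomial, if_neg one_ne_zero, Finset.mem_singleton]
  exact monomial_mem_of_le (le_inf hwu (Finset.le_sup (f := id) hw))
    (Ideal.subset_span ⟨w, hw, rfl⟩)

theorem insert_mem_koszulFaces_of_lt {m : Fin n →₀ ℕ}
    (hm : ∀ u : Fin n →₀ ℕ, MvPolynomial.monomial u (1 : k) ∈ I →
      MvPolynomial.monomial (u ⊓ m) (1 : k) ∈ I) {b : Fin n →₀ ℕ} {i : Fin n} (hi : m i < b i)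
    {τ : Finset (Fin n)} (hτ : τ ∈ koszulFaces I b) : insert i τ ∈ koszulFaces I b := by
  refine ⟨fun l => ?_, monomial_mem_of_le (fun l => ?_) (hm _ hτ.2)⟩
  · have hl := hτ.1 l
    rw [indicator_apply] at hl ⊢
    grind
  · rw [Finsupp.inf_apply, Finsupp.tsub_apply, Finsupp.tsub_apply, indicator_apply,
      indicator_apply]
    grind

theorem subsingleton_homology {b : Fin n →₀ ℕ} {i : Fin n}
    (h : ∀ τ ∈ koszulFaces I b, i ∉ τ → insert i τ ∈ koszulFaces I b) (j : ℕ) :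
    Subsingleton (homology I b j) := by
  refine subsingleton_of_forall_eq 0 fun y => ?_
  obtain ⟨z, rfl⟩ := Submodule.Quotient.mk_surjective _ y
  refine (Submodule.Quotient.mk_eq_zero _).2
    ⟨⟨addVertex i (inclusion I b z.1), addVertex_mem_supported h z.1.2⟩,
      addVertex_card z.2.1, inclusion_injective b ?_⟩
  have hz : boundary (inclusion I b z.1) = 0 := congrArg (inclusion I b) z.2.2
  have hcone := boundary_addVertex i (inclusion I b z.1)
  rwa [hz, map_zero, add_zero] at hcone

instance (b : Fin n →₀ ℕ) : FiniteDimensional k (chains I b) :=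
  inferInstanceAs (FiniteDimensional k (Finsupp.supported k k (koszulFaces I b)))

theorem finite_stage (hI : IsMonomialIdeal I) (i : ℕ) :
    Module.Finite (MvPolynomial (Fin n) k) (stage I i) := by
  obtain ⟨m, hm⟩ := hI.exists_bound
  refine finite_directSum (Finset.Iic m) fun b hb => ?_
  obtain ⟨l, hl⟩ : ∃ l, m l < b l := by
    by_contra! h
    exact hb (Finset.mem_Iic.2 h)
  have : Subsingleton (homology I b i) :=
    subsingleton_homology (fun τ hτ _ => insert_mem_koszulFaces_of_lt hm hl hτ) i
  infer_instance

end Finiteness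

section DirectSum

variable {R ι : Type*} [Semiring R] {A B C : ι → Type*} {M N P : Type*}
  [∀ c, AddCommMonoid (A c)] [∀ c, AddCommMonoid (B c)] [∀ c, AddCommMonoid (C c)]
  [AddCommMonoid M] [AddCommMonoid N] [AddCommMonoid P] [∀ c, Module R (A c)]
  [∀ c, Module R (B c)] [∀ c, Module R (C c)] [Module R M] [Module R N] [Module R P]

theorem exact_lmap {φ : ∀ c, A c →ₗ[R] B c} {γ : ∀ c, B c →ₗ[R] C c}
    (h : ∀ c, Function.Exact (φ c) (γ c)) :
    Function.Exact (DirectSum.lmap φ) (DirectSum.lmap γ) := by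
  rw [LinearMap.exact_iff, DirectSum.ker_lmap, DirectSum.range_lmap]
  exact congrArg (fun p => (Submodule.pi Set.univ p).comap _)
    (funext fun c => (h c).linearMap_ker_eq)

variable [DecidableEq ι]

theorem range_toModule_le {j : ∀ c, C c →ₗ[R] P} {Q : Submodule R P}
    (hj : ∀ c, LinearMap.range (j c) ≤ Q) : LinearMap.range (DirectSum.toModule R ι P j) ≤ Q := by
  rintro _ ⟨x, rfl⟩
  induction x using DirectSum.induction_on with
  | zero => exact (map_zero (DirectSum.toModule R ι P j)).symm ▸ zero_mem Q
  | add x y hx hy => exact (map_add (DirectSum.toModule R ι P j) x y).symm ▸ add_mem hx hy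
  | of c x =>
    rw [← DirectSum.lof_eq_of R, DirectSum.toModule_lof]
    exact hj c ⟨x, rfl⟩

theorem injective_toModule {j : ∀ c, C c →ₗ[R] P} {π : ∀ c, P →ₗ[R] C c}
    (hself : ∀ c x, π c (j c x) = x) (hne : ∀ c c' x, c ≠ c' → π c' (j c x) = 0) :
    Function.Injective (DirectSum.toModule R ι P j) := by
  have hπ (c : ι) : π c ∘ₗ DirectSum.toModule R ι P j = DirectSum.component R ι C c := by
    refine DirectSum.linearMap_ext _ fun c' => LinearMap.ext fun x => ?_
    simp only [LinearMap.comp_apply, DirectSum.toModule_lof]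
    rcases eq_or_ne c' c with rfl | hc
    · rw [hself, DirectSum.component.lof_self]
    · rw [hne _ _ _ hc, DirectSum.component.of, dif_neg hc]
  refine fun x y hxy => DirectSum.ext_component R fun c => ?_
  rw [← hπ c, LinearMap.comp_apply, hxy, LinearMap.comp_apply]

theorem exact_of_exact_degreewise {iM : ∀ c, A c →ₗ[R] M} {iN : ∀ c, B c →ₗ[R] N}
    {iP : ∀ c, C c →ₗ[R] P} (hM : Function.Surjective (DirectSum.toModule R ι M iM))
    (hN : Function.Surjective (DirectSum.toModule R ι N iN))
    (hP : Function.Injective (DirectSum.toModule R ι P iP)) {f : M →ₗ[R] N} {g : N →ₗ[R] P}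
    {φ : ∀ c, A c →ₗ[R] B c} {γ : ∀ c, B c →ₗ[R] C c}
    (hf : ∀ c x, f (iM c x) = iN c (φ c x)) (hg : ∀ c y, g (iN c y) = iP c (γ c y))
    (h : ∀ c, Function.Exact (φ c) (γ c)) : Function.Exact f g := by
  have hf' : f ∘ₗ DirectSum.toModule R ι M iM =
      DirectSum.toModule R ι N iN ∘ₗ DirectSum.lmap φ :=
    DirectSum.linearMap_ext _ fun c => LinearMap.ext fun x => by
      simp only [LinearMap.comp_apply, DirectSum.toModule_lof, DirectSum.lmap_lof, hf]
  have hg' : g ∘ₗ DirectSum.toModule R ι N iN =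
      DirectSum.toModule R ι P iP ∘ₗ DirectSum.lmap γ :=
    DirectSum.linearMap_ext _ fun c => LinearMap.ext fun y => by
      simp only [LinearMap.comp_apply, DirectSum.toModule_lof, DirectSum.lmap_lof, hg]
  replace hf' := LinearMap.congr_fun hf'
  replace hg' := LinearMap.congr_fun hg'
  simp only [LinearMap.comp_apply] at hf' hg'
  refine fun y => ⟨fun hy => ?_, ?_⟩
  · obtain ⟨y, rfl⟩ := hN y
    rw [hg', map_eq_zero_iff _ hP] at hy
    obtain ⟨x, rfl⟩ := (exact_lmap h y).1 hy
    exact ⟨_, hf' x⟩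
  · rintro ⟨x, rfl⟩
    obtain ⟨x, rfl⟩ := hM x
    rw [hf', hg', (exact_lmap h).apply_apply_eq_zero, map_zero]

end DirectSum

section GradedSum

variable {k : Type*} [Field k] {n : ℕ} {H H' : (Fin n →₀ ℕ) → Type*} [∀ b, AddCommGroup (H b)]
  [∀ b, Module k (H b)] [∀ b, AddCommGroup (H' b)] [∀ b, Module k (H' b)]

variable (k H) in
/-- The `ℕ^n`-graded free module `⨁ b, H b ⊗ k[x](-b)`. -/
abbrev gradedSum : Type _ :=
  ⨁ b, MvPolynomial (Fin n) k ⊗[k] H b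

/-- The map `h ↦ x^u ⊗ h` to the summand of index `b`. -/
def lofMonomial (b u : Fin n →₀ ℕ) : H b →ₗ[k] gradedSum k H :=
  (DirectSum.lof (MvPolynomial (Fin n) k) (Fin n →₀ ℕ)
    (fun b => MvPolynomial (Fin n) k ⊗[k] H b) b).restrictScalars k ∘ₗ
    TensorProduct.mk k _ _ (MvPolynomial.monomial u 1)

theorem lofMonomial_apply (b u : Fin n →₀ ℕ) (h : H b) :
    lofMonomial b u h = DirectSum.lof (MvPolynomial (Fin n) k) (Fin n →₀ ℕ)
      (fun b => MvPolynomial (Fin n) k ⊗[k] H b) b (MvPolynomial.monomial u 1 ⊗ₜ h) :=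
  rfl

/-- The map `h ↦ ∑ b, x^(c-b) ⊗ h b`, an isomorphism to the part of degree `c`. -/
def assemble (c : Fin n →₀ ℕ) : supportedBelow k H c →ₗ[k] gradedSum k H :=
  sumBelow (fun b => lofMonomial b (c - b)) c

theorem lofMonomial_mem_range_assemble (b u : Fin n →₀ ℕ) (h : H b) :
    lofMonomial b u h ∈ LinearMap.range (assemble (k := k) (H := H) (b + u)) := by
  classical
  have hb : Pi.single b h ∈ supportedBelow k H (b + u) := fun b' hb' =>
    Pi.single_eq_of_ne (fun hb => hb' (hb.le.trans le_self_add)) h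
  refine ⟨⟨_, hb⟩, ?_⟩
  rw [assemble, sumBelow_apply, Finset.sum_eq_single_of_mem b (Finset.mem_Iic.2 le_self_add)]
  · change lofMonomial b (b + u - b) (Pi.single b h b) = _
    rw [Pi.single_eq_same, add_tsub_cancel_left]
  · intro b' _ hb'
    change lofMonomial b' (b + u - b') (Pi.single b h b') = 0
    rw [Pi.single_eq_of_ne hb', map_zero]

theorem span_lofMonomial :
    Submodule.span k {y | ∃ (b u : Fin n →₀ ℕ) (h : H b), y = lofMonomial b u h} =
      (⊤ : Submodule k (gradedSum k H)) := by
  refine Submodule.eq_top_iff'.2 fun y => ?_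
  induction y using DirectSum.induction_on with
  | zero => exact zero_mem _
  | add y z hy hz => exact add_mem hy hz
  | of b x =>
    induction x using TensorProduct.induction_on with
    | zero => rw [map_zero]; exact zero_mem _
    | add x y hx hy => rw [map_add]; exact add_mem hx hy
    | tmul p h =>
      induction p using MvPolynomial.induction_on' with
      | monomial u r =>
        refine Submodule.subset_span ⟨b, u, r • h, ?_⟩
        rw [lofMonomial_apply, ← TensorProduct.smul_tmul, MvPolynomial.smul_monomial,
          smul_eq_mul, mul_one, DirectSum.lof_eq_of]
      | add p q hp hq => rw [TensorProduct.add_tmul, map_add]; exact add_mem hp hq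

theorem toModule_assemble_surjective :
    Function.Surjective (DirectSum.toModule k (Fin n →₀ ℕ) (gradedSum k H) assemble) := by
  rw [← LinearMap.range_eq_top, eq_top_iff, ← span_lofMonomial, Submodule.span_le]
  rintro _ ⟨b, u, h, rfl⟩
  obtain ⟨x, hx⟩ := lofMonomial_mem_range_assemble (k := k) b u h
  exact ⟨DirectSum.lof k _ _ (b + u) x, by rw [DirectSum.toModule_lof, hx]⟩

/-- The coefficient of `x^u` in an element of `k[x] ⊗ M`. -/
def tensorCoeff {M : Type*} [AddCommGroup M] [Module k M] (u : Fin n →₀ ℕ) :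
    MvPolynomial (Fin n) k ⊗[k] M →ₗ[k] M :=
  TensorProduct.lid k M ∘ₗ (MvPolynomial.lcoeff k u).rTensor M

theorem tensorCoeff_tmul {M : Type*} [AddCommGroup M] [Module k M] (u : Fin n →₀ ℕ)
    (p : MvPolynomial (Fin n) k) (m : M) : tensorCoeff u (p ⊗ₜ[k] m) = p.coeff u • m :=
  rfl

open scoped Classical in
/-- The projection to the part of degree `c`. -/
def homogeneousPart (c : Fin n →₀ ℕ) : gradedSum k H →ₗ[k] supportedBelow k H c :=
  (LinearMap.pi fun b => if b ≤ c then
      tensorCoeff (c - b) ∘ₗ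
        (DirectSum.component (MvPolynomial (Fin n) k) _ _ b).restrictScalars k
    else 0).codRestrict _ fun y b hb => by
    rw [LinearMap.pi_apply, if_neg hb, LinearMap.zero_apply]
    exact zero_mem _

theorem homogeneousPart_apply {b c : Fin n →₀ ℕ} (hb : b ≤ c) (y : gradedSum k H) :
    (homogeneousPart c y).1 b = tensorCoeff (c - b) (y b) :=
  LinearMap.congr_fun (if_pos hb) y

theorem assemble_apply {c : Fin n →₀ ℕ} (x : supportedBelow k H c) (b : Fin n →₀ ℕ) :
    assemble c x b = MvPolynomial.monomial (c - b) 1 ⊗ₜ x.1 b := by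
  classical
  rw [assemble, sumBelow_apply, DirectSum.sum_apply, Finset.sum_eq_single b]
  · exact DirectSum.of_eq_same b _
  · exact fun b' _ hb' => DirectSum.of_eq_of_ne _ _ _ hb'.symm
  · intro hb
    rw [supportedBelow.apply_eq_zero x (mt Finset.mem_Iic.2 hb), map_zero, DirectSum.zero_apply]

theorem homogeneousPart_assemble_apply {c : Fin n →₀ ℕ} (c' : Fin n →₀ ℕ)
    (x : supportedBelow k H c) (b : Fin n →₀ ℕ) :
    (homogeneousPart c' (assemble c x)).1 b = if c = c' then x.1 b else 0 := by
  by_cases hbc : b ≤ c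
  · by_cases hb : b ≤ c'
    · rw [homogeneousPart_apply hb, assemble_apply, tensorCoeff_tmul, MvPolynomial.coeff_monomial]
      simp only [tsub_left_inj hbc hb, ite_smul, one_smul, zero_smul]
    · rw [supportedBelow.apply_eq_zero _ hb, if_neg fun h : c = c' => hb (h ▸ hbc)]
  · by_cases hb : b ≤ c'
    · rw [homogeneousPart_apply hb, assemble_apply, supportedBelow.apply_eq_zero x hbc,
        TensorProduct.tmul_zero, map_zero, ite_self]
    · rw [supportedBelow.apply_eq_zero _ hb, supportedBelow.apply_eq_zero x hbc, ite_self]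

theorem homogeneousPart_assemble {c : Fin n →₀ ℕ} (x : supportedBelow k H c) :
    homogeneousPart c (assemble c x) = x :=
  supportedBelow.ext fun b => (homogeneousPart_assemble_apply c x b).trans (if_pos rfl)

theorem homogeneousPart_assemble_of_ne {c c' : Fin n →₀ ℕ} (hc : c ≠ c')
    (x : supportedBelow k H c) : homogeneousPart c' (assemble c x) = 0 :=
  supportedBelow.ext fun b => (homogeneousPart_assemble_apply c' x b).trans (if_neg hc)

theorem toModule_assemble_injective :
    Function.Injective (DirectSum.toModule k (Fin n →₀ ℕ) (gradedSum k H) assemble) :=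
  injective_toModule (π := homogeneousPart) (fun _ => homogeneousPart_assemble)
    fun _ _ x hc => homogeneousPart_assemble_of_ne hc x

end GradedSum

section GradedMap

variable {k : Type*} [Field k] {n : ℕ} {H H' : (Fin n →₀ ℕ) → Type*} [∀ b, AddCommGroup (H b)]
  [∀ b, Module k (H b)] [∀ b, AddCommGroup (H' b)] [∀ b, Module k (H' b)]
  {f : ∀ a b, H b →ₗ[k] H' a}

/-- The homomorphism of `ℕ^n`-graded free modules whose component from the summand of index `b` to
the summand of index `a ≤ b` is induced by `f a b`. -/
def gradedMap (f : ∀ a b, H b →ₗ[k] H' a) :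
    gradedSum k H →ₗ[MvPolynomial (Fin n) k] gradedSum k H' :=
  DirectSum.toModule _ _ _ fun b =>
    ∑ a ∈ Finset.Iic b, DirectSum.lof _ _ _ a ∘ₗ inducedMap a b (f a b)

theorem gradedMap_lof (f : ∀ a b, H b →ₗ[k] H' a) (b : Fin n →₀ ℕ)
    (x : MvPolynomial (Fin n) k ⊗[k] H b) :
    gradedMap f (DirectSum.lof (MvPolynomial (Fin n) k) (Fin n →₀ ℕ) _ b x) =
      ∑ a ∈ Finset.Iic b, DirectSum.lof (MvPolynomial (Fin n) k) (Fin n →₀ ℕ) _ a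
        (inducedMap a b (f a b) x) := by
  rw [gradedMap, DirectSum.toModule_lof, LinearMap.sum_apply]
  rfl

theorem inducedMap_zero {M M' : Type*} [AddCommGroup M] [Module k M] [AddCommGroup M'] [Module k M']
    (a b : Fin n →₀ ℕ) : inducedMap a b (0 : M →ₗ[k] M') = 0 := by
  rw [inducedMap, LinearMap.baseChange_zero, smul_zero]

theorem component_gradedMap (hf : ∀ a b, ¬ a ≤ b → f a b = 0) (a b : Fin n →₀ ℕ) :
    DirectSum.component (MvPolynomial (Fin n) k) _ _ a ∘ₗ gradedMap f ∘ₗ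
      DirectSum.lof (MvPolynomial (Fin n) k) _ _ b = inducedMap a b (f a b) := by
  refine LinearMap.ext fun x => ?_
  rw [LinearMap.comp_apply, LinearMap.comp_apply, gradedMap_lof, map_sum, Finset.sum_eq_single a]
  · exact DirectSum.component.lof_self _ _ _
  · exact fun a' _ ha' => by rw [DirectSum.component.of, dif_neg ha']
  · intro hab
    rw [hf a b (mt Finset.mem_Iic.2 hab), inducedMap_zero, LinearMap.zero_apply, map_zero, map_zero]

theorem gradedMap_lofMonomial (hf : ∀ a b, ¬ a ≤ b → f a b = 0) {b c : Fin n →₀ ℕ} (hbc : b ≤ c)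
    (h : H b) :
    gradedMap f (lofMonomial b (c - b) h) =
      ∑ a ∈ Finset.Iic c, lofMonomial a (c - a) (f a b h) := by
  rw [lofMonomial_apply, gradedMap_lof]
  refine Finset.sum_subset_zero_on_sdiff (Finset.Iic_subset_Iic.2 hbc) (fun a ha => ?_)
    fun a ha => ?_
  · rw [Finset.mem_sdiff, Finset.mem_Iic, Finset.mem_Iic] at ha
    rw [hf a b ha.2, LinearMap.zero_apply, map_zero]
  · rw [inducedMap, LinearMap.smul_apply, LinearMap.baseChange_tmul, TensorProduct.smul_tmul',
      smul_eq_mul, MvPolynomial.monomial_mul, one_mul, add_comm,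
      tsub_add_tsub_cancel hbc (Finset.mem_Iic.1 ha), lofMonomial_apply]

theorem gradedMap_assemble (hf : ∀ a b, ¬ a ≤ b → f a b = 0) (c : Fin n →₀ ℕ)
    (x : supportedBelow k H c) :
    gradedMap f (assemble c x) = assemble c (matrixBelow f hf c x) := by
  rw [assemble, assemble, sumBelow_apply, sumBelow_apply, map_sum,
    Finset.sum_congr rfl fun b hb => gradedMap_lofMonomial hf (Finset.mem_Iic.1 hb) (x.1 b),
    Finset.sum_comm]
  refine Finset.sum_congr rfl fun a _ => ?_
  rw [matrixBelow_apply, sumBelow_apply, map_sum]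

theorem exact_gradedMap {H'' : (Fin n →₀ ℕ) → Type*} [∀ b, AddCommGroup (H'' b)]
    [∀ b, Module k (H'' b)] {g : ∀ a b, H' b →ₗ[k] H'' a} (hf : ∀ a b, ¬ a ≤ b → f a b = 0)
    (hg : ∀ a b, ¬ a ≤ b → g a b = 0)
    (h : ∀ c, Function.Exact (matrixBelow f hf c) (matrixBelow g hg c)) :
    Function.Exact (gradedMap f) (gradedMap g) :=
  exact_of_exact_degreewise toModule_assemble_surjective toModule_assemble_surjective
    toModule_assemble_injective (f := (gradedMap f).restrictScalars k)
    (g := (gradedMap g).restrictScalars k) (gradedMap_assemble hf) (gradedMap_assemble hg) h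

theorem monomial_mem_span_range_X {u : Fin n →₀ ℕ} (hu : u ≠ 0) :
    MvPolynomial.monomial u (1 : k) ∈ Ideal.span (Set.range MvPolynomial.X) := by
  classical
  obtain ⟨i, hi⟩ := Finsupp.ne_iff.1 hu
  rw [← Set.image_univ, MvPolynomial.mem_ideal_span_X_image]
  intro m hm
  rw [Finset.mem_singleton.1 (MvPolynomial.support_monomial_subset hm)]
  exact ⟨i, trivial, hi⟩

theorem range_gradedMap_le (hf : ∀ a b, ¬ a < b → f a b = 0) :
    LinearMap.range (gradedMap f) ≤ (Ideal.span (Set.range MvPolynomial.X) :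
      Ideal (MvPolynomial (Fin n) k)) • ⊤ := by
  refine range_toModule_le fun b => ?_
  rintro _ ⟨x, rfl⟩
  rw [LinearMap.sum_apply]
  refine sum_mem fun a _ => ?_
  rw [LinearMap.comp_apply]
  by_cases hab : a < b
  · rw [inducedMap, LinearMap.smul_apply, map_smul]
    exact Submodule.smul_mem_smul
      (monomial_mem_span_range_X fun h => hab.not_ge (tsub_eq_zero_iff_le.1 h)) trivial
  · rw [hf a b hab, inducedMap_zero, LinearMap.zero_apply, map_zero]
    exact zero_mem _

/-- The homomorphism to `k[x]` that sends `p ⊗ h` in the summand of index `b` to `x^b f(h) p`. -/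
def augmentationMap (f : ∀ b, H b →ₗ[k] k) :
    gradedSum k H →ₗ[MvPolynomial (Fin n) k] MvPolynomial (Fin n) k :=
  DirectSum.toModule _ _ _ fun b =>
    (MvPolynomial.monomial b ∘ₗ f b).liftBaseChange (MvPolynomial (Fin n) k)

theorem augmentationMap_assemble (f : ∀ b, H b →ₗ[k] k) (c : Fin n →₀ ℕ)
    (x : supportedBelow k H c) :
    augmentationMap f (assemble c x) = MvPolynomial.monomial c (sumBelow f c x) := by
  rw [assemble, sumBelow_apply, sumBelow_apply, map_sum, map_sum]
  refine Finset.sum_congr rfl fun b hb => ?_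
  rw [lofMonomial_apply, augmentationMap, DirectSum.toModule_lof, LinearMap.liftBaseChange_tmul,
    LinearMap.comp_apply, smul_eq_mul, MvPolynomial.monomial_mul, one_mul,
    tsub_add_cancel_of_le (Finset.mem_Iic.1 hb)]

theorem toModule_monomial_injective : Function.Injective
    (DirectSum.toModule k (Fin n →₀ ℕ) (MvPolynomial (Fin n) k) MvPolynomial.monomial) := by
  classical
  exact injective_toModule (π := MvPolynomial.lcoeff k)
    (fun c r => by rw [MvPolynomial.lcoeff_apply, MvPolynomial.coeff_monomial, if_pos rfl])
    fun c c' r hc => by rw [MvPolynomial.lcoeff_apply, MvPolynomial.coeff_monomial, if_neg hc]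

theorem exact_augmentationMap {g : ∀ b, H' b →ₗ[k] k} (hf : ∀ a b, ¬ a ≤ b → f a b = 0)
    (h : ∀ c, Function.Exact (matrixBelow f hf c) (sumBelow g c)) :
    Function.Exact (gradedMap f) (augmentationMap g) :=
  exact_of_exact_degreewise toModule_assemble_surjective toModule_assemble_surjective
    toModule_monomial_injective (f := (gradedMap f).restrictScalars k)
    (g := (augmentationMap g).restrictScalars k) (gradedMap_assemble hf)
    (augmentationMap_assemble g) h

theorem range_augmentationMap_le {I : Ideal (MvPolynomial (Fin n) k)} {f : ∀ b, H b →ₗ[k] k}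
    (hf : ∀ b h, MvPolynomial.monomial b (f b h) ∈ I) :
    LinearMap.range (augmentationMap f) ≤ I := by
  refine range_toModule_le fun b => ?_
  rw [LinearMap.range_liftBaseChange, Submodule.span_le]
  rintro _ ⟨h, rfl⟩
  exact hf b h

end GradedMap

section Resolution

variable {k : Type*} [Field k] {n : ℕ} {I : Ideal (MvPolynomial (Fin n) k)}
  (s : ∀ b, Splitting I b)

theorem gradedPiece_eq_range_assemble (i : ℕ) (c : Fin n →₀ ℕ) :
    gradedPiece I i c = LinearMap.range (assemble (k := k) (H := (homology I · i)) c) := by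
  refine le_antisymm (Submodule.span_le.2 ?_) ?_
  · rintro _ ⟨b, u, h, rfl, rfl⟩
    exact lofMonomial_mem_range_assemble (H := (homology I · i)) b u h
  · rintro _ ⟨x, rfl⟩
    rw [assemble, sumBelow_apply]
    exact sum_mem fun b hb => Submodule.subset_span
      ⟨b, c - b, x.1 b, add_tsub_cancel_of_le (Finset.mem_Iic.1 hb), rfl⟩

theorem homologyMap_eq_zero_of_not_le (i : ℕ) (a b : Fin n →₀ ℕ) (hab : ¬ a ≤ b) :
    homologyMap s a b i = 0 :=
  homologyMap_eq_zero s i (mt le_of_lt hab)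

/-- The differential of the resolution. -/
def resolutionDiff (i : ℕ) : stage I (i + 1) →ₗ[MvPolynomial (Fin n) k] stage I i :=
  gradedMap fun a b => homologyMap s a b i

theorem resolutionDiff_mem_gradedPiece {i : ℕ} {c : Fin n →₀ ℕ} {y : stage I (i + 1)}
    (hy : y ∈ gradedPiece I (i + 1) c) : resolutionDiff s i y ∈ gradedPiece I i c := by
  rw [gradedPiece_eq_range_assemble] at hy ⊢
  obtain ⟨x, rfl⟩ := hy
  exact ⟨_, (gradedMap_assemble (homologyMap_eq_zero_of_not_le s i) c x).symm⟩

theorem monomial_homologyAugmentation_mem (b : Fin n →₀ ℕ) (h : homology I b 0) :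
    MvPolynomial.monomial b (homologyAugmentation (s b) h) ∈ I := by
  by_cases hb : ∅ ∈ koszulFaces I b
  · have hbI : MvPolynomial.monomial b (1 : k) ∈ I := by
      simpa only [indicator_empty, tsub_zero] using hb.2
    rw [← mul_one (homologyAugmentation (s b) h), ← MvPolynomial.C_mul_monomial]
    exact I.mul_mem_left _ hbI
  · have h0 : homologyAugmentation (s b) h = 0 := inclusion_apply_eq_zero _ hb
    rw [h0, map_zero]
    exact zero_mem I

/-- The augmentation of the resolution. -/
def resolutionAugmentation : stage I 0 →ₗ[MvPolynomial (Fin n) k] I :=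
  (augmentationMap fun b => homologyAugmentation (s b)).codRestrict I fun y =>
    range_augmentationMap_le (monomial_homologyAugmentation_mem s) ⟨y, rfl⟩

theorem resolutionAugmentation_assemble (c : Fin n →₀ ℕ)
    (x : supportedBelow k (homology I · 0) c) :
    (resolutionAugmentation s (assemble c x) : MvPolynomial (Fin n) k) =
      MvPolynomial.monomial c (degreeAugmentation s c x) :=
  augmentationMap_assemble _ c x

theorem exists_resolutionAugmentation_eq_monomial {c : Fin n →₀ ℕ} {y : stage I 0}
    (hy : y ∈ gradedPiece I 0 c) :
    ∃ r, (resolutionAugmentation s y : MvPolynomial (Fin n) k) = MvPolynomial.monomial c r := by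
  rw [gradedPiece_eq_range_assemble] at hy
  obtain ⟨x, rfl⟩ := hy
  exact ⟨_, resolutionAugmentation_assemble s c x⟩

theorem exact_resolutionAugmentation :
    Function.Exact (resolutionDiff s 0) (resolutionAugmentation s) :=
  (Subtype.val_injective.comp_exact_iff_exact (i := I.subtype)).1 <|
    exact_augmentationMap (homologyMap_eq_zero_of_not_le s 0) (exact_degreeAugmentation s)

theorem resolutionAugmentation_surjective (hI : IsMonomialIdeal I) :
    Function.Surjective (resolutionAugmentation s) := by
  obtain ⟨S, hS⟩ := hI
  have h : I ≤ (LinearMap.range (resolutionAugmentation s)).map I.subtype := by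
    refine hS.le.trans (Submodule.span_le.2 ?_)
    rintro _ ⟨c, hc, rfl⟩
    have hcI : MvPolynomial.monomial c (1 : k) ∈ I :=
      hS ▸ Ideal.subset_span (Set.mem_image_of_mem _ hc)
    obtain ⟨x, hx⟩ := degreeAugmentation_surjective s hcI 1
    exact ⟨_, ⟨assemble c x, rfl⟩, (resolutionAugmentation_assemble s c x).trans (by rw [hx])⟩
  rintro ⟨p, hp⟩
  obtain ⟨_, ⟨y, rfl⟩, hy⟩ := h hp
  exact ⟨y, Subtype.ext hy⟩

theorem isMinimalFreeResolution (hI : IsMonomialIdeal I) :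
    IsMinimalFreeResolution (Ideal.span (Set.range MvPolynomial.X)) (stage I) (resolutionDiff s)
      (resolutionAugmentation s) where
  free _ := inferInstance
  finite i := finite_stage hI i
  exact i := exact_gradedMap (homologyMap_eq_zero_of_not_le s (i + 1))
    (homologyMap_eq_zero_of_not_le s i) (exact_degreeDiff s i)
  exact_augmentation := exact_resolutionAugmentation s
  surjective := resolutionAugmentation_surjective s hI
  minimal i := range_gradedMap_le fun _ _ hab => homologyMap_eq_zero s i hab

theorem component_resolutionDiff (i : ℕ) (a b : Fin n →₀ ℕ) :
    DirectSum.component (MvPolynomial (Fin n) k) _ _ a ∘ₗ resolutionDiff s i ∘ₗ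
      DirectSum.lof (MvPolynomial (Fin n) k) _ _ b = inducedMap a b (homologyMap s a b i) :=
  component_gradedMap (homologyMap_eq_zero_of_not_le s i) a b

end Resolution

end KoszulSplit

end

theorem theorem7p1 {k : Type*} [Field k] {n : ℕ} (I : Ideal (MvPolynomial (Fin n) k))
    (hI : KoszulSplit.IsMonomialIdeal I) (s : ∀ b : Fin n →₀ ℕ, KoszulSplit.Splitting I b) :
    ∃ (D : ∀ i, KoszulSplit.stage I (i + 1) →ₗ[MvPolynomial (Fin n) k] KoszulSplit.stage I i)
      (ε : KoszulSplit.stage I 0 →ₗ[MvPolynomial (Fin n) k] I),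
      -- the component of `D i` from the summand of index `b` to the summand of index `a`
      (∀ (i : ℕ) (a b : Fin n →₀ ℕ),
        DirectSum.component (MvPolynomial (Fin n) k) _ _ a ∘ₗ D i ∘ₗ
            DirectSum.lof (MvPolynomial (Fin n) k) _ _ b =
          KoszulSplit.inducedMap a b (KoszulSplit.homologyMap s a b i)) ∧
      KoszulSplit.IsMinimalFreeResolution (Ideal.span (Set.range MvPolynomial.X))
        (KoszulSplit.stage I) D ε ∧
      -- the resolution is graded by `ℕ^n`
      (∀ (i : ℕ) (c : Fin n →₀ ℕ), ∀ y ∈ KoszulSplit.gradedPiece I (i + 1) c,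
        D i y ∈ KoszulSplit.gradedPiece I i c) ∧
      (∀ (c : Fin n →₀ ℕ), ∀ y ∈ KoszulSplit.gradedPiece I 0 c,
        ∃ r : k, (ε y : MvPolynomial (Fin n) k) = MvPolynomial.monomial c r) :=
  ⟨KoszulSplit.resolutionDiff s, KoszulSplit.resolutionAugmentation s,
    KoszulSplit.component_resolutionDiff s,
    KoszulSplit.isMinimalFreeResolution s hI,
    fun _ _ _ hy => KoszulSplit.resolutionDiff_mem_gradedPiece s hy,
    fun _ _ hy => KoszulSplit.exists_resolutionAugmentation_eq_monomial s hy⟩
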